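/- Let $p$ be a prime number and let $G$ be a non-abelian group of order $p^3$. Let $K$ be a field such that either (i) $\operatorname{char} K = p$, or (ii) $\operatorname{char} K \neq p$ and $K$ contains a primitive $p$-th root of unity. Let $K(x_g : g \in G)$ be the field of rational functions over $K$ in independent variables indexed by $G$, on which $G$ acts by $K$-automorphisms with $g \cdot x_h = x_{gh}$ for all $g, h \in G$, and let $K(G) = K(x_g : g \in G)^G$ be the fixed field. Then $K(G)$ is rational (that is, purely transcendental) over $K$: there are finitely many elements of $K(G)$ that are algebraically independent over $K$ and generate $K(G)$ as a field over $K$. -/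

import Mathlib

/-- The rational function field `K(x_g : g ∈ G)`. -/
abbrev RegularFunctionField (K G : Type*) [Field K] : Type _ :=
  FractionRing (MvPolynomial G K)

/-- The action of `G` on `K(x_g : g ∈ G)` by `K`-automorphisms with `g · x_h = x_{gh}`: the
permutation `h ↦ g * h` of the variables, extended from polynomials to fractions. -/
noncomputable def regularAction (K G : Type*) [Field K] [Group G] :
    G →* (RegularFunctionField K G ≃ₐ[K] RegularFunctionField K G) where
  toFun g := IsFractionRing.fieldEquivOfAlgEquiv K (RegularFunctionField K G)
    (RegularFunctionField K G) (MvPolynomial.renameEquiv K (Equiv.mulLeft g))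
  map_one' := by
    rw [Equiv.mulLeft_one]
    exact (congrArg _ (MvPolynomial.renameEquiv_refl K)).trans
      (map_one (IsFractionRing.fieldEquivOfAlgEquivHom K (RegularFunctionField K G)))
  map_mul' g h := by
    rw [show MvPolynomial.renameEquiv K (Equiv.mulLeft (g * h)) =
        MvPolynomial.renameEquiv K (Equiv.mulLeft g) *
          MvPolynomial.renameEquiv K (Equiv.mulLeft h) by
      ext x; simp [mul_assoc]]
    exact map_mul (IsFractionRing.fieldEquivOfAlgEquivHom K (RegularFunctionField K G)) _ _

/-- The fixed field `K(G) = K(x_g : g ∈ G)^G`. -/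
noncomputable def noetherField (K G : Type*) [Field K] [Group G] :
    IntermediateField K (RegularFunctionField K G) :=
  IntermediateField.fixedField (regularAction K G).range

/-- The field extension `L` of `K` is rational (purely transcendental, of finite transcendence
degree): it is generated over `K` by finitely many algebraically independent elements. -/
def IsRationalOver (K L : Type*) [Field K] [Field L] [Algebra K L] : Prop :=
  ∃ (n : ℕ) (x : Fin n → L),
    AlgebraicIndependent K x ∧ IntermediateField.adjoin K (Set.range x) = ⊤

/-! `F = K(x_g)` is the function field of the regular representation V, the span of the variables.
Independence of generators of the fixed field is never checked by hand: since F is algebraic over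
`K(G)`, at most |G| = trdeg F elements generating `K(G)` are automatically independent. So it is
enough to generate `K(G)` by |G| elements.

In characteristic p a p-group acts unipotently, so V has a stable flag in which each new vector x is
fixed modulo the previous step. Passing from a field M to M(x) adds a single generator to the
invariants, an invariant polynomial in x of least positive degree (`exists_invariant_generator`).

Otherwise Speiser's lemma gives the no-name lemma: for a faithful subrepresentation U, F is
generated over K(U) by at most |G| − dim U invariants. It remains to find dim U invariants from
which U is reached by adjoining three p-th roots in succession. Then F has degree at most p³ = |G|
over the field generated by all these invariants, and Artin's theorem makes that field the fixed
field (`IsRegularSystem.isRationalOver_of_subrepresentation`).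

Such a U exists in both remaining cases. If some noncentral a satisfies a^p = 1 (always so for odd
p), U is induced from a character of ⟨a, Z(G)⟩: a acts diagonally and some t by a twisted cyclic
shift. If not, p = 2 and G is the quaternion group, acting on the quaternions by left
multiplication; the entries of the associated rotation matrix provide the invariants. -/

/-! ### Recognizing rational fields and fixed fields by counting -/

open IntermediateField in
/-- A subfield over which a field is algebraic, and which is generated by at most as many elements
as the transcendence degree, is rational. -/
theorem isRationalOver_of_card_le_trdeg {K F : Type*} [Field K] [Field F] [Algebra K F]
    (L : IntermediateField K F) [Algebra.IsAlgebraic L F] (s : Finset F)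
    (hs : adjoin K (s : Set F) = L) (hcard : (s.card : Cardinal) ≤ Algebra.trdeg K F) :
    IsRationalOver K L := by
  subst hs
  have alg : Algebra.IsAlgebraic (Algebra.adjoin K (Set.range ((↑) : s → F))) F := by
    have h : Set.range ((↑) : s → F) = (s : Set F) := by ext; simp
    rw [h]
    exact isAlgebraic_adjoin_iff_top.mp inferInstance
  have hind : AlgebraicIndependent K ((↑) : s → F) :=
    (Algebra.IsAlgebraic.isTranscendenceBasis_of_le_trdeg_of_finite K ((↑) : s → F) (by simpa using hcard)).1
  let e := s.equivFin.symm
  let x : Fin s.card → adjoin K (s : Set F) := fun i ↦ ⟨e i, subset_adjoin K _ (e i).2⟩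
  refine ⟨s.card, x, ?_, ?_⟩
  · rw [← AlgHom.algebraicIndependent_iff (adjoin K (s : Set F)).val Subtype.val_injective]
    exact hind.comp e e.injective
  · apply (adjoin K (s : Set F)).lift_injective
    rw [lift_adjoin, lift_top]
    congr 1
    ext y
    simp only [Set.mem_image, Set.mem_range, exists_exists_eq_and, x, Finset.mem_coe]
    exact ⟨fun ⟨i, hi⟩ ↦ hi ▸ (e i).2, fun hy ↦ ⟨e.symm ⟨y, hy⟩, by simp⟩⟩

open IntermediateField in
/-- A finite family of generators with at most as many members as the transcendence degree is
algebraically independent. -/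
theorem algebraicIndependent_of_adjoin_eq_top {K F : Type*} [Field K] [Field F] [Algebra K F]
    {ι : Type*} [Finite ι] (x : ι → F) (hx : adjoin K (Set.range x) = ⊤)
    (hcard : (Nat.card ι : Cardinal) ≤ Algebra.trdeg K F) : AlgebraicIndependent K x := by
  have alg : Algebra.IsAlgebraic (Algebra.adjoin K (Set.range x)) F := by
    refine isAlgebraic_adjoin_iff_top.mp ?_
    rw [hx]
    exact ⟨fun a ↦ isAlgebraic_algebraMap (⟨a, trivial⟩ : (⊤ : IntermediateField K F))⟩
  refine (Algebra.IsAlgebraic.isTranscendenceBasis_of_lift_le_trdeg_of_finite K x ?_).1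
  rw [← Nat.cast_card (α := ι), Cardinal.lift_natCast]
  exact (Cardinal.lift_natCast _).symm.le.trans (Cardinal.lift_le.mpr hcard)

-- The element `e` is a root of X^p − e^p. An upper bound suffices, so irreducibility of this
-- polynomial is never needed: Artin's theorem supplies the matching lower bound.
open IntermediateField in
theorem relrank_adjoin_insert_le {K F : Type*} [Field K] [Field F] [Algebra K F] {S : Set F}
    {e : F} {p : ℕ} (hp : 0 < p) (he : e ^ p ∈ adjoin K S) :
    relrank (adjoin K S) (adjoin K (insert e S)) ≤ p := by
  have hle : adjoin K S ≤ adjoin K (insert e S) := adjoin.mono _ _ _ (Set.subset_insert _ _)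
  have hext : extendScalars hle = adjoin (adjoin K S) {e} := by
    apply restrictScalars_injective K
    rw [extendScalars_restrictScalars, restrictScalars_adjoin_eq_sup, ← adjoin_union,
      Set.union_singleton]
  rw [relrank_eq_rank_of_le hle, hext]
  let c : adjoin K S := ⟨e ^ p, he⟩
  have hmonic : (Polynomial.X ^ p - Polynomial.C c).Monic := Polynomial.monic_X_pow_sub_C c hp.ne'
  have heval : Polynomial.aeval e (Polynomial.X ^ p - Polynomial.C c) = 0 := by
    simp [c]
  have hint : IsIntegral (adjoin K S) e := ⟨_, hmonic, heval⟩
  have : FiniteDimensional (adjoin K S) (adjoin (adjoin K S) {e}) :=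
    adjoin.finiteDimensional hint
  rw [← Module.finrank_eq_rank, adjoin.finrank hint]
  have := Polynomial.natDegree_le_natDegree (minpoly.min _ e hmonic heval)
  rw [Polynomial.natDegree_X_pow_sub_C] at this
  exact_mod_cast this

open IntermediateField in
/-- Artin's theorem, used to recognize a fixed field from a bound on the degree. -/
theorem adjoin_eq_fixedField {K F : Type*} [Field K] [Field F] [Algebra K F]
    (H : Subgroup (F ≃ₐ[K] F)) [Finite H] {S : Set F} (hS : S ⊆ fixedField H)
    {p : ℕ} (hp : 0 < p) (hH : Nat.card H = p ^ 3) (e₁ e₂ e₃ : F)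
    (h₁ : e₁ ^ p ∈ adjoin K S) (h₂ : e₂ ^ p ∈ adjoin K (insert e₁ S))
    (h₃ : e₃ ^ p ∈ adjoin K (insert e₂ (insert e₁ S)))
    (htop : adjoin K (insert e₃ (insert e₂ (insert e₁ S))) = ⊤) :
    adjoin K S = fixedField H := by
  have hle : adjoin K S ≤ fixedField H := adjoin_le_iff.2 hS
  have hrank : Module.rank (fixedField H) F = (p ^ 3 : ℕ) := by
    have := Fintype.ofFinite H
    have h := FixedPoints.finrank_eq_card H F
    rw [← Nat.card_eq_fintype_card, hH] at h
    rw [← h]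
    exact (Module.finrank_eq_rank (FixedPoints.subfield H F) F).symm
  have hbound : relrank (adjoin K S) ⊤ ≤ (p ^ 3 : ℕ) := by
    rw [← htop]
    have mono : ∀ (e : F) (T : Set F), adjoin K T ≤ adjoin K (insert e T) := fun e T ↦
      adjoin.mono _ _ _ (Set.subset_insert _ _)
    rw [← relrank_mul_relrank ((mono e₁ S).trans (mono e₂ _)) (mono e₃ _),
      ← relrank_mul_relrank (mono e₁ S) (mono e₂ _)]
    calc _ ≤ (p : Cardinal) * p * p := by
          gcongr <;> exact relrank_adjoin_insert_le hp ‹_›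
      _ = (p ^ 3 : ℕ) := by push_cast; ring
  rw [relrank_top_right, ← relrank_mul_rank_top hle, hrank] at hbound
  refine le_antisymm hle (relrank_eq_one_iff.mp (le_antisymm ?_ ?_))
  · have hpos : 0 < p ^ 3 := pow_pos hp 3
    -- Cancelling p³ from `hbound` is illegitimate for infinite cardinals, so finiteness of the
    -- relative degree comes first.
    have hlt : relrank (adjoin K S) (fixedField H) < Cardinal.aleph0 := by
      by_contra hinf
      rw [not_lt] at hinf
      have := (Cardinal.aleph0_le_mul_iff.mpr ⟨by
        intro h0; rw [h0] at hinf; exact Cardinal.aleph0_ne_zero (by simpa using hinf), by exact_mod_cast hpos.ne',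
          Or.inl hinf⟩).trans hbound
      exact absurd this (not_le.mpr (Cardinal.natCast_lt_aleph0))
    obtain ⟨m, hm⟩ := Cardinal.lt_aleph0.mp hlt
    rw [hm] at hbound ⊢
    have : m * p ^ 3 ≤ 1 * p ^ 3 := by rw [one_mul]; exact_mod_cast hbound
    exact_mod_cast Nat.le_of_mul_le_mul_right this hpos
  · rw [relrank_eq_rank_of_le hle, Cardinal.one_le_iff_pos]
    exact rank_pos

/-! ### Linear forms in the regular representation -/

/-- `F` is the field of rational functions in the variables `X g`, permuted by `G` through `ρ` as
in the left regular representation. -/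
structure IsRegularSystem {K F G : Type*} [Field K] [Field F] [Algebra K F] [Group G]
    (ρ : G →* (F ≃ₐ[K] F)) (X : G → F) : Prop where
  algebraicIndependent : AlgebraicIndependent K X
  adjoin_eq_top : IntermediateField.adjoin K (Set.range X) = ⊤
  apply_var : ∀ g h, ρ g (X h) = X (g * h)

/-- A basis of a subspace extended to a basis of a finite-dimensional space containing it. -/
theorem exists_finset_basis_extension {K F : Type*} [Field K] [AddCommGroup F] [Module K F]
    {U V : Submodule K F} (hUV : U ≤ V) [FiniteDimensional K V] :
    ∃ B C : Finset F, Disjoint B C ∧ LinearIndepOn K id ((B : Set F) ∪ C) ∧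
      Submodule.span K (B : Set F) = U ∧ Submodule.span K ((B : Set F) ∪ C) = V ∧
      B.card = Module.finrank K U ∧ B.card + C.card = Module.finrank K V := by
  classical
  have : FiniteDimensional K U := Submodule.finiteDimensional_of_le hUV
  obtain ⟨b, hbU, hbspan, hbind⟩ := exists_linearIndependent K (U : Set F)
  rw [Submodule.span_eq] at hbspan
  obtain ⟨c, hcV, hbc, hcspan, hcind⟩ :=
    exists_linearIndepOn_id_extension hbind (hbU.trans hUV)
  have hcspan' : Submodule.span K c = V := le_antisymm (Submodule.span_le.2 hcV) hcspan
  have hcfin : c.Finite := by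
    have h : LinearIndependent K fun x : c ↦ (⟨x, hcV x.2⟩ : V) :=
      LinearIndependent.of_comp V.subtype hcind
    exact Set.finite_coe_iff.mp h.finite
  obtain ⟨b, rfl⟩ := (hcfin.subset hbc).exists_finset_coe
  obtain ⟨c, rfl⟩ := hcfin.exists_finset_coe
  have hsub : b ⊆ c := by exact_mod_cast hbc
  have hunion : (b : Set F) ∪ ↑(c \ b) = c := by simpa using hbc
  refine ⟨b, c \ b, Finset.disjoint_sdiff, ?_⟩
  rw [hunion]
  refine ⟨hcind, hbspan, hcspan', ?_, ?_⟩
  · rw [← hbspan, finrank_span_finset_eq_card hbind]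
  · rw [add_comm, Finset.card_sdiff_add_card_eq_card hsub, ← hcspan',
      finrank_span_finset_eq_card hcind]

namespace IsRegularSystem

open IntermediateField Submodule

variable {K F G : Type*} [Field K] [Field F] [Algebra K F] [Group G]
  {ρ : G →* (F ≃ₐ[K] F)} {X : G → F}

theorem trdeg_eq [Finite G] (h : IsRegularSystem ρ X) :
    Algebra.trdeg K F = (Nat.card G : Cardinal) := by
  have htop : Algebra.IsAlgebraic (adjoin K (Set.range X)) F := by
    rw [h.adjoin_eq_top]
    exact ⟨fun a ↦ isAlgebraic_algebraMap (⟨a, trivial⟩ : (⊤ : IntermediateField K F))⟩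
  have hb : IsTranscendenceBasis K X :=
    h.algebraicIndependent.isTranscendenceBasis_iff_isAlgebraic.mpr
      (isAlgebraic_adjoin_iff_top.mp htop)
  have := hb.lift_cardinalMk_eq_trdeg
  rw [← Nat.cast_card (α := G), Cardinal.lift_natCast] at this
  exact Cardinal.lift_injective (this.symm.trans (Cardinal.lift_natCast _).symm)

theorem finrank_span [Finite G] (h : IsRegularSystem ρ X) :
    Module.finrank K (span K (Set.range X)) = Nat.card G := by
  have := Fintype.ofFinite G
  rw [finrank_span_eq_card h.algebraicIndependent.linearIndependent, Nat.card_eq_fintype_card]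

instance [Finite G] : FiniteDimensional K (span K (Set.range X)) :=
  FiniteDimensional.span_of_finite K (Set.finite_range X)

theorem injective (h : IsRegularSystem ρ X) : Function.Injective ρ := by
  intro a b hab
  have := h.apply_var a 1
  rw [hab, h.apply_var b 1] at this
  simpa using (h.algebraicIndependent.injective this).symm

theorem card_range (h : IsRegularSystem ρ X) : Nat.card ρ.range = Nat.card G :=
  (Nat.card_congr (MonoidHom.ofInjective h.injective).toEquiv).symm

theorem apply_mem_span (h : IsRegularSystem ρ X) (g : G) {v : F} (hv : v ∈ span K (Set.range X)) :
    ρ g v ∈ span K (Set.range X) := by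
  induction hv using span_induction with
  | mem x hx =>
    obtain ⟨k, rfl⟩ := hx
    rw [h.apply_var]
    exact subset_span ⟨_, rfl⟩
  | zero => rw [map_zero]; exact zero_mem _
  | add x y _ _ hx hy => rw [map_add]; exact add_mem hx hy
  | smul c x _ hx => rw [map_smul]; exact smul_mem _ _ hx

theorem adjoin_eq_top_of_span_le (h : IsRegularSystem ρ X) {S : Set F}
    (hS : span K (Set.range X) ≤ span K S) : adjoin K S = ⊤ := by
  rw [eq_top_iff, ← h.adjoin_eq_top, adjoin_le_iff]
  rintro _ ⟨g, rfl⟩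
  have : span K S ≤ (adjoin K S).toSubalgebra.toSubmodule := span_le.2 (subset_adjoin K S)
  exact this (hS (subset_span ⟨g, rfl⟩))

/-- Linearly independent linear forms are algebraically independent. -/
theorem algebraicIndepOn_of_linearIndepOn [Finite G] (h : IsRegularSystem ρ X) {S : Set F}
    (hS : S ⊆ span K (Set.range X)) (hind : LinearIndepOn K id S) :
    AlgebraicIndepOn K id S := by
  obtain ⟨B, C, -, hBC, hB, hV, hcB, hc⟩ := exists_finset_basis_extension
    (span_le.2 hS : span K S ≤ span K (Set.range X))
  rw [h.finrank_span] at hc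
  have hSfin : S.Finite := by
    have h : LinearIndependent K fun x : S ↦ (⟨x, hS x.2⟩ : span K (Set.range X)) :=
      LinearIndependent.of_comp (span K (Set.range X)).subtype hind
    exact Set.finite_coe_iff.mp h.finite
  classical
  obtain ⟨S, rfl⟩ := hSfin.exists_finset_coe
  -- `S` takes the place of the basis `B` of its span: `S ∪ C` still spans all linear forms, hence
  -- generates `F`, and has only |G| = trdeg F members.
  have hT : adjoin K (Set.range ((↑) : ↥(S ∪ C) → F)) = ⊤ := by
    apply h.adjoin_eq_top_of_span_le
    have : Set.range ((↑) : ↥(S ∪ C) → F) = (S : Set F) ∪ C := by ext; simp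
    rw [← hV, this, span_union, span_union, hB]
  have hcard : (S ∪ C).card ≤ Nat.card G := by
    refine (Finset.card_union_le _ _).trans ?_
    rw [← hc, hcB, finrank_span_finset_eq_card hind]
  have : AlgebraicIndepOn K id (↑(S ∪ C) : Set F) :=
    algebraicIndependent_of_adjoin_eq_top ((↑) : ↥(S ∪ C) → F) hT
      (by rw [h.trdeg_eq, Nat.card_eq_fintype_card, Fintype.card_coe]; exact_mod_cast hcard)
  exact this.mono (by simp)

theorem algebraicIndependent_of_linearIndependent [Finite G] (h : IsRegularSystem ρ X)
    {ι : Type*} {v : ι → F} (hv : ∀ i, v i ∈ span K (Set.range X)) (hind : LinearIndependent K v) :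
    AlgebraicIndependent K v := by
  have := h.algebraicIndepOn_of_linearIndepOn (Set.range_subset_iff.2 hv) hind.linearIndepOn_id
  exact (algebraicIndependent_subtype_range hind.injective).mp this

theorem isRationalOver_fixedField [Finite G] (h : IsRegularSystem ρ X) (s : Finset F)
    (hcard : s.card ≤ Nat.card G) (hs : adjoin K (s : Set F) = fixedField ρ.range) :
    IsRationalOver K (fixedField ρ.range) := by
  have : Finite ρ.range := Set.finite_range ρ
  have : Algebra.IsAlgebraic (fixedField ρ.range) F :=
    ⟨fun x ↦ (FixedPoints.isIntegral ρ.range F x).isAlgebraic⟩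
  refine isRationalOver_of_card_le_trdeg _ s hs ?_
  rw [h.trdeg_eq]
  exact_mod_cast hcard

end IsRegularSystem

/-! ### Speiser's lemma and reduction to a faithful subrepresentation -/

section Descent

open IntermediateField Submodule

variable {K F G : Type*} [Field K] [Field F] [Algebra K F] [Group G]

/-- Speiser's lemma: a semilinear representation of a finite group acting faithfully on the
scalars is spanned by its invariants. -/
theorem le_span_invariants [Finite G] (ρ : G →* (F ≃ₐ[K] F)) (M : IntermediateField K F)
    (hM : ∀ g, ∀ m ∈ M, ρ g m ∈ M) (hfaith : ∀ g, (∀ m ∈ M, ρ g m = m) → g = 1)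
    (W : Submodule M F) (hW : ∀ g, ∀ w ∈ W, ρ g w ∈ W) :
    W ≤ span M {w | w ∈ W ∧ ∀ g, ρ g w = w} := by
  have := Fintype.ofFinite G
  intro w hw
  by_contra hnot
  obtain ⟨φ, hφw, hφ⟩ := exists_le_ker_of_notMem hnot
  let σ : G → (M →* M) := fun g ↦
    { toFun := fun m ↦ ⟨ρ g m, hM g m m.2⟩
      map_one' := Subtype.ext (by simp)
      map_mul' := fun a b ↦ Subtype.ext (by simp) }
  have hσ : Function.Injective σ := by
    intro a b hab
    rw [← inv_mul_eq_one]
    refine hfaith _ fun m hm ↦ ?_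
    have h : ρ a m = ρ b m := congrArg Subtype.val (DFunLike.congr_fun hab ⟨m, hm⟩)
    rw [map_mul, AlgEquiv.mul_apply, ← h, ← AlgEquiv.mul_apply, ← map_mul, inv_mul_cancel, map_one,
      AlgEquiv.one_apply]
  have hlin := (linearIndependent_monoidHom M M).comp σ hσ
  -- For every m in `M` the trace Σ ρ_g(m w) is invariant, hence killed by `φ`. This is a linear
  -- relation between the distinct characters `σ g` with coefficients φ(ρ_g w); Dedekind
  -- independence forces φ(w) = 0, against the choice of `φ`.
  have hsum : ∑ g, φ (ρ g w) • (⇑(σ g) : M → M) = 0 := by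
    funext m
    have hmem : ∑ g, ρ g ((m : F) * w) ∈ span M {w | w ∈ W ∧ ∀ g, ρ g w = w} := by
      refine subset_span ⟨sum_mem fun g _ ↦ hW g _ (W.smul_mem m hw), fun k ↦ ?_⟩
      rw [map_sum]
      exact Fintype.sum_equiv (Equiv.mulLeft k) _ _ fun g ↦ by simp
    have h0 := hφ hmem
    rw [LinearMap.mem_ker, map_sum] at h0
    rw [Finset.sum_apply, Pi.zero_apply, ← h0]
    refine Finset.sum_congr rfl fun g _ ↦ ?_
    have : ρ g ((m : F) * w) = σ g m • ρ g w := by rw [map_mul]; rfl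
    rw [this, map_smul, smul_eq_mul, mul_comm]
    rfl
  have := Fintype.linearIndependent_iff.mp hlin (fun g ↦ φ (ρ g w)) hsum 1
  rw [map_one, AlgEquiv.one_apply] at this
  exact hφw this

/-- The no-name lemma: the regular representation field is generated over the field of a faithful
subrepresentation by the expected number of invariants. -/
theorem IsRegularSystem.exists_invariants [Finite G] {ρ : G →* (F ≃ₐ[K] F)} {X : G → F}
    (h : IsRegularSystem ρ X) (U : Submodule K F) (hUV : U ≤ span K (Set.range X))
    (hU : ∀ g, ∀ u ∈ U, ρ g u ∈ U) (hne : U ≠ ⊥) (hfaith : ∀ g, (∀ u ∈ U, ρ g u = u) → g = 1) :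
    ∃ z : Finset F, z.card + Module.finrank K U ≤ Nat.card G ∧ (∀ x ∈ z, ∀ g, ρ g x = x) ∧
      adjoin K ((U : Set F) ∪ z) = ⊤ := by
  classical
  set M := adjoin K (U : Set F) with hMdef
  have hM : ∀ g, ∀ m ∈ M, ρ g m ∈ M := by
    intro g
    have : M ≤ M.comap (ρ g : F →ₐ[K] F) :=
      adjoin_le_iff.2 fun u hu ↦ subset_adjoin K _ (hU g u hu)
    exact this
  have hMfaith : ∀ g, (∀ m ∈ M, ρ g m = m) → g = 1 := fun g hg ↦
    hfaith g fun u hu ↦ hg u (subset_adjoin K _ hu)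
  set W : Submodule M F := span M (span K (Set.range X) : Set F) with hWdef
  have hW : ∀ g, ∀ w ∈ W, ρ g w ∈ W := by
    intro g w hw
    induction hw using span_induction with
    | mem x hx => exact subset_span (h.apply_mem_span g hx)
    | zero => rw [map_zero]; exact zero_mem _
    | add x y _ _ hx hy => rw [map_add]; exact add_mem hx hy
    | smul c x _ hx =>
      rw [show c • x = (c : F) * x from rfl, map_mul]
      exact W.smul_mem ⟨ρ g c, hM g c c.2⟩ hx
  have hUW : ∀ u ∈ U, u ∈ W ∧ u ∈ span M ({1} : Set F) := fun u hu ↦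
    ⟨subset_span (hUV hu), mem_span_singleton.2 ⟨⟨u, subset_adjoin K _ hu⟩, mul_one u⟩⟩
  have h1W : (1 : F) ∈ W := by
    obtain ⟨u, hu, hu0⟩ := U.exists_mem_ne_zero_of_ne_bot hne
    have := W.smul_mem (⟨u, subset_adjoin K _ hu⟩⁻¹ : M) (hUW u hu).1
    rwa [show (⟨u, subset_adjoin K _ hu⟩⁻¹ : M) • u = u⁻¹ * u from rfl, inv_mul_cancel₀ hu0] at this
  obtain ⟨B, C, -, -, hB, hBC, hcB, hc⟩ := exists_finset_basis_extension hUV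
  rw [h.finrank_span] at hc
  -- Over `M` all of `U` collapses into the line of 1, so `1` and a complement of `U` span `W`.
  have hWC : W = span M (↑(insert 1 C) : Set F) := by
    refine le_antisymm (span_le.2 ?_) (span_le.2 ?_)
    · have hle : span K ((B : Set F) ∪ C) ≤ (span M (↑(insert 1 C) : Set F)).restrictScalars K := by
        refine span_le.2 (Set.union_subset (fun x hx ↦ ?_) fun x hx ↦ ?_)
        · have hxU : x ∈ U := hB ▸ subset_span hx
          exact span_mono (by simp) (hUW x hxU).2
        · exact subset_span (by simpa using Or.inr hx)
      rw [hBC] at hle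
      exact hle
    · intro x hx
      rw [Finset.coe_insert, Set.mem_insert_iff] at hx
      obtain rfl | hx := hx
      · exact h1W
      · exact subset_span (hBC ▸ subset_span (Or.inr hx))
  have hWdim : Module.finrank M W ≤ C.card + 1 := by
    rw [hWC]
    exact (finrank_span_finset_le_card _).trans (Finset.card_insert_le _ _)
  have : FiniteDimensional M W := by rw [hWC]; exact FiniteDimensional.span_finset M _
  -- The basis of invariants is made to contain 1, which contributes nothing as a field generator.
  -- Erasing it lowers the bound dim W ≤ |G| − dim U + 1 to the required one.
  obtain ⟨b, hb, h1b, hbspan, hbind⟩ := exists_linearIndepOn_id_extension (K := M)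
    (s := {(1 : F)}) (t := {w | w ∈ W ∧ ∀ g, ρ g w = w})
    (LinearIndepOn.singleton one_ne_zero) (by simpa using h1W)
  have hbW : span M b = W := le_antisymm (span_le.2 fun x hx ↦ (hb hx).1)
    ((le_span_invariants ρ M hM hMfaith W hW).trans (span_le.2 hbspan))
  have hbfin : b.Finite := by
    have h : LinearIndependent M fun x : b ↦ (⟨x, (hb x.2).1⟩ : W) :=
      LinearIndependent.of_comp W.subtype hbind
    exact Set.finite_coe_iff.mp h.finite
  obtain ⟨b, rfl⟩ := hbfin.exists_finset_coe
  have hbcard : b.card = Module.finrank M W := by rw [← hbW, finrank_span_finset_eq_card hbind]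
  have h1b' : (1 : F) ∈ b := by simpa using h1b
  refine ⟨b.erase 1, ?_, fun x hx ↦ (hb (Finset.mem_of_mem_erase hx)).2, ?_⟩
  · have := Finset.card_erase_add_one h1b'
    omega
  · rw [eq_top_iff, ← h.adjoin_eq_top, adjoin_le_iff]
    rintro _ ⟨g, rfl⟩
    have hX : X g ∈ span M (b : Set F) := hbW ▸ subset_span (subset_span ⟨g, rfl⟩)
    change X g ∈ adjoin K ((U : Set F) ∪ ↑(b.erase 1))
    generalize X g = y at hX
    induction hX using span_induction with
    | mem x hx =>
      by_cases hx1 : x = 1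
      · rw [hx1]; exact one_mem _
      · exact subset_adjoin K _ (Or.inr (Finset.mem_coe.2 (Finset.mem_erase.2 ⟨hx1, hx⟩)))
    | zero => exact zero_mem _
    | add x y _ _ hx hy => exact add_mem hx hy
    | smul c x _ hx => exact mul_mem (adjoin.mono K _ _ Set.subset_union_left c.2) hx

/-- Rationality of the fixed field, from invariants of a faithful subrepresentation over which
that subrepresentation is reached by three radicals. -/
theorem IsRegularSystem.isRationalOver_of_subrepresentation [Finite G] {ρ : G →* (F ≃ₐ[K] F)}
    {X : G → F} (h : IsRegularSystem ρ X) (U : Submodule K F) (hUV : U ≤ span K (Set.range X))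
    (hU : ∀ g, ∀ u ∈ U, ρ g u ∈ U) (hne : U ≠ ⊥) (hfaith : ∀ g, (∀ u ∈ U, ρ g u = u) → g = 1)
    {p : ℕ} (hp : 0 < p) (hG : Nat.card G = p ^ 3) (f : Finset F)
    (hf : f.card ≤ Module.finrank K U) (hinv : ∀ x ∈ f, ∀ g, ρ g x = x) (e₁ e₂ e₃ : F)
    (h₁ : e₁ ^ p ∈ adjoin K (f : Set F)) (h₂ : e₂ ^ p ∈ adjoin K (insert e₁ (f : Set F)))
    (h₃ : e₃ ^ p ∈ adjoin K (insert e₂ (insert e₁ (f : Set F))))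
    (hUf : (U : Set F) ⊆ adjoin K (insert e₃ (insert e₂ (insert e₁ (f : Set F))))) :
    IsRationalOver K (fixedField ρ.range) := by
  classical
  obtain ⟨z, hz, hzinv, htop⟩ := h.exists_invariants U hUV hU hne hfaith
  have : Finite ρ.range := Set.finite_range ρ
  have hsub : (f : Set F) ⊆ ↑(f ∪ z) := by simp
  refine h.isRationalOver_fixedField (f ∪ z) ((Finset.card_union_le _ _).trans (by omega))
    (adjoin_eq_fixedField ρ.range ?_ hp (h.card_range.trans hG) e₁ e₂ e₃
      (adjoin.mono _ _ _ hsub h₁) (adjoin.mono _ _ _ (Set.insert_subset_insert hsub) h₂)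
      (adjoin.mono _ _ _ (Set.insert_subset_insert (Set.insert_subset_insert hsub)) h₃) ?_)
  · intro x hx
    rw [SetLike.mem_coe, mem_fixedField_iff]
    rintro _ ⟨g, rfl⟩
    rw [Finset.mem_coe, Finset.mem_union] at hx
    exact hx.elim (fun hx ↦ hinv x hx g) fun hx ↦ hzinv x hx g
  · rw [eq_top_iff, ← htop, adjoin_le_iff]
    refine Set.union_subset (fun u hu ↦ adjoin.mono _ _ _ ?_ (hUf hu)) fun x hx ↦
      subset_adjoin K _ ?_
    · exact Set.insert_subset_insert (Set.insert_subset_insert (Set.insert_subset_insert hsub))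
    · exact Or.inr (Or.inr (Or.inr (by simpa using Or.inr hx)))

end Descent

/-! ### Characteristic p: unipotent flags -/

section Unipotent

open IntermediateField Submodule

/-- A nontrivial representation of a finite `p`-group in characteristic `p` has a nonzero fixed
vector. -/
theorem exists_fixed_vector_of_isPGroup {K Q G : Type*} [Field K] [AddCommGroup Q] [Module K Q]
    [Group G] [Finite G] {p : ℕ} [Fact p.Prime] [CharP K p] (hG : IsPGroup p G)
    (θ : G →* Module.End K Q) {v : Q} (hv : v ≠ 0) : ∃ w : Q, w ≠ 0 ∧ ∀ g, θ g w = w := by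
  -- `Q` may be infinite, so fixed points are counted in the additive group generated by the orbit
  -- of `v`. It is finitely generated and killed by p, hence finite of order divisible by p, and 0
  -- cannot be its only fixed point.
  set A : AddSubgroup Q := AddSubgroup.closure (Set.range fun g ↦ θ g v) with hA
  have hAstable : ∀ g, ∀ a ∈ A, θ g a ∈ A := by
    intro g
    have : A ≤ A.comap (θ g).toAddMonoidHom := by
      rw [hA, AddSubgroup.closure_le]
      rintro _ ⟨k, rfl⟩
      refine AddSubgroup.subset_closure ⟨g * k, ?_⟩
      simp
    exact this
  have hvA : v ∈ A := AddSubgroup.subset_closure ⟨1, by simp⟩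
  have hpA : ∀ a : A, p • a = 0 := fun a ↦ Subtype.ext (by
    have : ((p : K)) • (a : Q) = 0 := by rw [CharP.cast_eq_zero, zero_smul]
    rw [Nat.cast_smul_eq_nsmul] at this
    exact this)
  let : Module (ZMod p) A := AddCommGroup.zmodModule hpA
  have hfg : AddGroup.FG A := (AddGroup.fg_iff_addSubgroup_fg A).2
    ((AddSubgroup.fg_iff _).2 ⟨_, hA.symm, Set.finite_range _⟩)
  have : Finite A := by
    have : Module.Finite ℤ A := Module.Finite.iff_addGroup_fg.mpr hfg
    have hfin : Module.Finite (ZMod p) A := Module.Finite.of_restrictScalars_finite ℤ (ZMod p) A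
    exact Module.finite_iff_finite.mp hfin
  let act : MulAction G A :=
    { smul := fun g a ↦ ⟨θ g a, hAstable g a a.2⟩
      one_smul := fun a ↦ Subtype.ext (by change θ 1 (a : Q) = a; simp)
      mul_smul := fun g k a ↦ Subtype.ext (by
        change θ (g * k) (a : Q) = θ g (θ k a); simp) }
  have hdvd : p ∣ Nat.card A := by
    have hne : (⟨v, hvA⟩ : A) ≠ 0 := fun h ↦ hv (congrArg Subtype.val h)
    rw [← addOrderOf_eq_prime (hpA _) hne]
    exact addOrderOf_dvd_natCard _
  obtain ⟨w, hw, hw0⟩ := hG.exists_fixed_point_of_prime_dvd_card_of_fixed_point A hdvd (a := 0)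
    (fun g ↦ Subtype.ext (map_zero (θ g)))
  exact ⟨w, fun h ↦ hw0 (Subtype.ext h.symm), fun g ↦ congrArg Subtype.val (hw g)⟩

variable {K F G : Type*} [Field K] [Field F] [Algebra K F] [Group G]

/-- A fixed vector of V/U, lifted to V: it extends a stable flag by one step. -/
theorem exists_fixed_vector_mod [Finite G] {p : ℕ} [Fact p.Prime] [CharP K p] (hG : IsPGroup p G)
    (ρ : G →* (F ≃ₐ[K] F)) {U V : Submodule K F} (hU : ∀ g, ∀ u ∈ U, ρ g u ∈ U)
    (hV : ∀ g, ∀ v ∈ V, ρ g v ∈ V) {v : F} (hv : v ∈ V) (hvU : v ∉ U) :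
    ∃ x ∈ V, x ∉ U ∧ ∀ g, ρ g x - x ∈ U := by
  let U' := U.comap V.subtype
  let r : G → V →ₗ[K] V := fun g ↦ (ρ g).toLinearMap.restrict (hV g)
  have hr : ∀ g, U' ≤ U'.comap (r g) := fun g u hu ↦ hU g _ hu
  let θ : G →* Module.End K (V ⧸ U') :=
    { toFun := fun g ↦ U'.mapQ U' (r g) (hr g)
      map_one' := by
        refine Submodule.linearMap_qext _ (LinearMap.ext fun u ↦ ?_)
        simp [r, LinearMap.restrict_apply]
      map_mul' := fun a b ↦ by
        refine Submodule.linearMap_qext _ (LinearMap.ext fun u ↦ ?_)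
        simp [r, LinearMap.restrict_apply]
        rfl }
  have hne : U'.mkQ ⟨v, hv⟩ ≠ 0 := by
    rw [Ne, mkQ_apply, Quotient.mk_eq_zero]
    exact hvU
  obtain ⟨w, hw, hwfix⟩ := exists_fixed_vector_of_isPGroup hG θ hne
  obtain ⟨x, rfl⟩ := U'.mkQ_surjective w
  refine ⟨x, x.2, ?_, fun g ↦ ?_⟩
  · rw [Ne, mkQ_apply, Quotient.mk_eq_zero] at hw
    exact hw
  · have : U'.mkQ (r g x - x) = 0 := by
      rw [map_sub, sub_eq_zero]
      exact hwfix g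
    rw [mkQ_apply, Quotient.mk_eq_zero] at this
    exact this

open Polynomial in
/-- A one-variable unipotent extension `M(x)` of a field with group action adds one invariant. -/
theorem exists_invariant_generator [Finite G] (ρ : G →* (F ≃ₐ[K] F)) (M : IntermediateField K F)
    (hM : ∀ g, ∀ m ∈ M, ρ g m ∈ M) {x : F} (hx : Transcendental M x)
    (hxg : ∀ g, ρ g x - x ∈ M) :
    ∃ f : F, (∀ g, ρ g f = f) ∧ ∀ y ∈ adjoin K (insert x (M : Set F)), (∀ g, ρ g y = y) →
      y ∈ adjoin K (insert f {m | m ∈ M ∧ ∀ g, ρ g m = m}) := by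
  classical
  have := Fintype.ofFinite G
  let σ : G → (M →+* M) := fun g ↦ ((ρ g : F →+* F).comp (algebraMap M F)).codRestrict
    M.toSubfield fun m ↦ hM g m m.2
  -- The action of g lifted to polynomials: it acts on coefficients and sends X to X + (ρ_g x − x).
  -- It preserves degrees, which makes division with remainder equivariant.
  let τ : G → (M[X] →+* M[X]) := fun g ↦
    (compRingHom (X + C ⟨_, hxg g⟩)).comp (mapRingHom (σ g))
  have hτ : ∀ g P, aeval x (τ g P) = ρ g (aeval x P) := by
    intro g P
    have h1 : (algebraMap M F).comp (σ g) = (ρ g : F →+* F).comp (algebraMap M F) := by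
      ext m; rfl
    have h2 : aeval x (X + C (⟨_, hxg g⟩ : M)) = ρ g x := by
      rw [map_add, aeval_X, aeval_C]
      exact add_sub_cancel x (ρ g x)
    change aeval x ((P.map (σ g)).comp _) = _
    rw [aeval_comp, h2, aeval_def, eval₂_map, h1, aeval_def]
    exact (hom_eval₂ P (algebraMap M F) (ρ g : F →+* F) x).symm
  have hτdeg : ∀ g P, (τ g P).natDegree = P.natDegree := by
    intro g P
    simp only [τ, RingHom.comp_apply, coe_compRingHom_apply, coe_mapRingHom, natDegree_comp,
      natDegree_X_add_C, mul_one]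
    exact natDegree_map_eq_of_injective (σ g).injective P
  have hinj : Function.Injective (aeval x : M[X] →ₐ[M] F) := _root_.transcendental_iff_injective.mp hx
  have hprod : ∀ (P : M[X]) g, ρ g (∏ k, ρ k (aeval x P)) = ∏ k, ρ k (aeval x P) := by
    intro P g
    rw [map_prod]
    exact Fintype.prod_equiv (Equiv.mulLeft g) _ _ fun k ↦ by simp
  let Inv : M[X] → Prop := fun P ↦ ∀ g, ρ g (aeval x P) = aeval x P
  -- The product of the conjugates of X is an invariant of positive degree, so one of least positive
  -- degree exists.
  have hex : ∃ d, ∃ P, Inv P ∧ P.natDegree = d ∧ 0 < d := by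
    refine ⟨_, ∏ g, τ g X, fun g ↦ ?_, rfl, ?_⟩
    · simp only [map_prod, hτ]
      rw [← map_prod]
      exact hprod X g
    · rw [natDegree_prod]
      · simp [hτdeg, Fintype.card_pos]
      · intro g _ h0
        have := hτdeg g X
        rw [h0] at this
        simp at this
  obtain ⟨f, hf, hfd, hfpos⟩ := Nat.find_spec hex
  have hmin : ∀ P, Inv P → P.natDegree < f.natDegree → P.natDegree = 0 := by
    intro P hP hlt
    by_contra h0
    rw [hfd] at hlt
    exact Nat.find_min hex hlt ⟨P, hP, rfl, Nat.pos_of_ne_zero h0⟩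
  rw [← hfd] at hfpos
  set L := adjoin K (insert (aeval x f) {m | m ∈ M ∧ ∀ g, ρ g m = m})
  have hconst : ∀ P, Inv P → P.natDegree = 0 → aeval x P ∈ L := by
    intro P hP h0
    rw [eq_C_of_natDegree_eq_zero h0] at hP ⊢
    refine subset_adjoin K _ (Or.inr ⟨?_, hP⟩)
    rw [aeval_C]
    exact (P.coeff 0).2
  have hpoly : ∀ n P, Inv P → P.natDegree = n → aeval x P ∈ L := by
    intro n
    induction n using Nat.strong_induction_on with
    | _ n ih =>
    rintro P hP rfl
    by_cases h0 : P.natDegree = 0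
    · exact hconst P hP h0
    have hP0 : P ≠ 0 := by rintro rfl; simp at h0
    have hf0 : f ≠ 0 := by rintro rfl; simp at hfpos
    have hdiv : f * (P / f) + P % f = P := EuclideanDomain.div_add_mod P f
    have hrdeg : (P % f).natDegree < f.natDegree := natDegree_mod_lt P hfpos.ne'
    -- Uniqueness of quotient and remainder: both `P` and `f` are fixed, so both results are. The
    -- remainder, being invariant of degree below that of `f`, is then constant.
    have hr : ∀ g, τ g (P / f) = P / f ∧ τ g (P % f) = P % f := by
      intro g
      have hfix : ∀ Q, Inv Q → τ g Q = Q := fun Q hQ ↦ hinj (by rw [hτ, hQ g])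
      have h1 := congrArg (τ g) hdiv
      rw [map_add, map_mul, hfix f hf, hfix P hP] at h1
      have h2 : f * (P / f - τ g (P / f)) = τ g (P % f) - P % f := by
        linear_combination hdiv - h1
      have h3 : τ g (P % f) - P % f = 0 := by
        refine eq_zero_of_dvd_of_natDegree_lt ⟨_, h2.symm⟩ ?_
        refine (natDegree_sub_le _ _).trans_lt ?_
        rw [hτdeg, max_self]
        exact hrdeg
      rw [h3, mul_eq_zero, or_iff_right hf0] at h2
      exact ⟨(sub_eq_zero.mp h2).symm, sub_eq_zero.mp h3⟩
    have hrI : Inv (P % f) := fun g ↦ by rw [← hτ, (hr g).2]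
    have hqI : Inv (P / f) := fun g ↦ by rw [← hτ, (hr g).1]
    rw [← hdiv, map_add, map_mul]
    refine add_mem (mul_mem (subset_adjoin K _ (Or.inl rfl)) ?_)
      (hconst _ hrI (hmin _ hrI hrdeg))
    by_cases hq0 : P / f = 0
    · rw [hq0, map_zero]; exact zero_mem _
    · exact ih _ (natDegree_lt_natDegree hq0
        (degree_div_lt hP0 (natDegree_pos_iff_degree_pos.mp hfpos))) _ hqI rfl
  refine ⟨aeval x f, hf, fun y hy hyinv ↦ ?_⟩
  have hy' : y ∈ adjoin M {x} := by
    rw [← mem_restrictScalars K, restrictScalars_adjoin, Set.union_singleton]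
    exact hy
  obtain ⟨r, s, rfl⟩ := (mem_adjoin_simple_iff M y).mp hy'
  by_cases hs : aeval x s = 0
  · rw [hs, div_zero]; exact zero_mem _
  -- Expanding the fraction r/s by the other conjugates of s makes the denominator a norm; as the
  -- fraction is invariant, so is the new numerator.
  have hN : aeval x (∏ g, τ g s) = ∏ g, ρ g (aeval x s) := by simp only [map_prod, hτ]
  have hN0 : aeval x (∏ g, τ g s) ≠ 0 := by
    rw [hN, Finset.prod_ne_zero_iff]
    exact fun g _ ↦ (map_ne_zero (ρ g)).2 hs
  have hNI : Inv (∏ g, τ g s) := fun g ↦ by rw [hN]; exact hprod s g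
  have hPeq : aeval x (r * ∏ g ∈ Finset.univ.erase 1, τ g s) =
      aeval x r / aeval x s * aeval x (∏ g, τ g s) := by
    rw [← Finset.mul_prod_erase Finset.univ _ (Finset.mem_univ (1 : G)), map_mul, map_mul, hτ,
      map_one, AlgEquiv.one_apply]
    field_simp
  have hPI : Inv (r * ∏ g ∈ Finset.univ.erase 1, τ g s) := fun g ↦ by
    rw [hPeq, map_mul, hyinv g, hNI g]
  rw [← mul_div_cancel_right₀ (aeval x r / aeval x s) hN0, ← hPeq]
  exact div_mem (hpoly _ _ hPI rfl) (hpoly _ _ hNI rfl)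

end Unipotent

open IntermediateField Submodule in
/-- In characteristic `p`, the fixed field of a finite `p`-group in its regular representation
field is rational. -/
theorem IsRegularSystem.isRationalOver_of_charP {K F G : Type*} [Field K] [Field F] [Algebra K F]
    [Group G] [Finite G] {ρ : G →* (F ≃ₐ[K] F)} {X : G → F} (h : IsRegularSystem ρ X) {p : ℕ}
    [Fact p.Prime] [CharP K p] (hG : IsPGroup p G) : IsRationalOver K (fixedField ρ.range) := by
  classical
  -- Induction along the flag: `B` is a basis of its k-dimensional step, and `s` consists of at most
  -- k generators for the invariants of K(B).
  have key : ∀ k ≤ Nat.card G, ∃ B : Finset F, B.card = k ∧ LinearIndepOn K id (B : Set F) ∧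
      (B : Set F) ⊆ span K (Set.range X) ∧ (∀ g, ∀ u ∈ span K (B : Set F), ρ g u ∈ span K B) ∧
      ∃ s : Finset F, s.card ≤ k ∧ (∀ y ∈ s, ∀ g, ρ g y = y) ∧
        ∀ y ∈ adjoin K (B : Set F), (∀ g, ρ g y = y) → y ∈ adjoin K (s : Set F) := by
    intro k
    induction k with
    | zero =>
      refine fun _ ↦ ⟨∅, rfl, by simp, by simp, by simp, ∅, le_rfl, by simp, fun y hy _ ↦ hy⟩
    | succ k ih =>
      intro hk
      obtain ⟨B, hBk, hBind, hBV, hB, s, hs, hsinv, hgen⟩ := ih (by omega)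
      have hlt : ∃ v ∈ span K (Set.range X), v ∉ span K (B : Set F) := by
        by_contra! hle
        have := Submodule.finrank_mono (R := K) hle
        rw [h.finrank_span, finrank_span_finset_eq_card hBind] at this
        omega
      obtain ⟨v, hv, hvB⟩ := hlt
      obtain ⟨x, hx, hxB, hxg⟩ := exists_fixed_vector_mod hG ρ hB (fun g v ↦ h.apply_mem_span g)
        hv hvB
      have hxB' : x ∉ B := fun hx ↦ hxB (subset_span hx)
      have hind : LinearIndepOn K id (insert x (B : Set F)) :=
        (linearIndepOn_id_insert (by simpa using hxB')).2 ⟨hBind, hxB⟩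
      have hsubV : insert x (B : Set F) ⊆ span K (Set.range X) := Set.insert_subset hx hBV
      have hspan_le : span K (B : Set F) ≤ (adjoin K (B : Set F)).toSubalgebra.toSubmodule :=
        span_le.2 (subset_adjoin K _)
      have htrans : Transcendental (adjoin K (B : Set F)) x := by
        have := ((AlgebraicIndepOn.insert_iff (by simpa using hxB')).mp
          (h.algebraicIndepOn_of_linearIndepOn hsubV hind)).2
        rw [Set.image_id] at this
        exact IntermediateField.transcendental_adjoin_iff.mpr this
      have hM : ∀ g, ∀ m ∈ adjoin K (B : Set F), ρ g m ∈ adjoin K (B : Set F) := by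
        intro g
        have : adjoin K (B : Set F) ≤ (adjoin K (B : Set F)).comap (ρ g : F →ₐ[K] F) :=
          adjoin_le_iff.2 fun u hu ↦ hspan_le (hB g u (subset_span hu))
        exact this
      obtain ⟨f, hf, hfgen⟩ := exists_invariant_generator ρ (adjoin K (B : Set F)) hM htrans
        fun g ↦ hspan_le (hxg g)
      refine ⟨insert x B, by rw [Finset.card_insert_of_notMem hxB', hBk],
        by simpa using hind, by simpa using hsubV, ?_, insert f s,
        (Finset.card_insert_le _ _).trans (by omega), ?_, ?_⟩
      · intro g
        have hle : span K (B : Set F) ≤ span K (↑(insert x B) : Set F) := span_mono (by simp)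
        have : span K (↑(insert x B) : Set F) ≤
            (span K (↑(insert x B) : Set F)).comap (ρ g).toLinearMap := by
          refine span_le.2 fun y hy ↦ ?_
          rw [Finset.coe_insert, Set.mem_insert_iff] at hy
          obtain rfl | hy := hy
          · have h1 := add_mem (hle (hxg g)) (subset_span (Finset.mem_coe.2 (Finset.mem_insert_self y B)))
            rwa [sub_add_cancel] at h1
          · exact hle (hB g y (subset_span hy))
        exact this
      · intro y hy g
        obtain rfl | hy := Finset.mem_insert.mp hy
        · exact hf g
        · exact hsinv y hy g
      · intro y hy hyinv
        have hy' : y ∈ adjoin K (insert x (adjoin K (B : Set F) : Set F)) := by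
          refine adjoin.mono K _ _ ?_ hy
          rw [Finset.coe_insert]
          exact Set.insert_subset_insert (subset_adjoin K _)
        refine adjoin_le_iff.2 (Set.insert_subset ?_ ?_) (hfgen y hy' hyinv)
        · exact subset_adjoin K _ (by simp)
        · rintro m ⟨hm, hminv⟩
          exact adjoin.mono K _ _ (by simp) (hgen m hm hminv)
  obtain ⟨B, hBn, hBind, hBV, -, s, hs, hsinv, hgen⟩ := key _ le_rfl
  have hBspan : span K (B : Set F) = span K (Set.range X) :=
    Submodule.eq_of_le_of_finrank_eq (span_le.2 hBV)
      (by rw [h.finrank_span, finrank_span_finset_eq_card hBind, hBn])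
  have htop : adjoin K (B : Set F) = ⊤ := h.adjoin_eq_top_of_span_le hBspan.ge
  refine h.isRationalOver_fixedField s hs (le_antisymm (adjoin_le_iff.2 fun y hy ↦ ?_) fun y hy ↦ ?_)
  · rw [SetLike.mem_coe, mem_fixedField_iff]
    rintro _ ⟨g, rfl⟩
    exact hsinv y hy g
  · rw [mem_fixedField_iff] at hy
    exact hgen y (by rw [htop]; trivial) fun g ↦ hy _ ⟨g, rfl⟩

/-! ### Invariants of the monomial representation -/

section Monomial

open IntermediateField Submodule

/-- A property closed under multiplication that holds on generators of a finite group holds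
everywhere. -/
theorem forall_of_closure_eq_top {G : Type*} [Group G] [Finite G] {S : Set G}
    (hS : Subgroup.closure S = ⊤) {P : G → Prop} (h1 : P 1) (hmul : ∀ a b, P a → P b → P (a * b))
    (hgen : ∀ a ∈ S, P a) (g : G) : P g := by
  have hg : g ∈ Submonoid.closure S := by
    rw [← Subgroup.closure_toSubmonoid_of_finite, hS]
    exact Subgroup.mem_top g
  induction hg using Submonoid.closure_induction with
  | mem x hx => exact hgen x hx
  | one => exact h1
  | mul a b _ _ ha hb => exact hmul a b ha hb

variable {K F : Type*} [Field K] [Field F] [Algebra K F]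

/-- Inversion of the finite Fourier transform. -/
theorem mem_of_fourier_mem (L : IntermediateField K F) {p : ℕ} {ζ : K} (hζ : IsPrimitiveRoot ζ p)
    (hp : (p : K) ≠ 0) (s : ℕ → F)
    (hs : ∀ j < p, ∑ i ∈ Finset.range p, algebraMap K F (ζ ^ (i * j)) * s i ∈ L) :
    ∀ i < p, s i ∈ L := by
  intro i hi
  have hζ0 : ζ ≠ 0 := hζ.ne_zero (by rintro rfl; simp at hp)
  have hgeom : ∀ k ∈ Finset.range p, (∑ j ∈ Finset.range p, (ζ ^ k * (ζ ^ i)⁻¹) ^ j) =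
      if k = i then (p : K) else 0 := by
    intro k hk
    split_ifs with hki
    · simp [hki, hζ0]
    · have hw1 : ζ ^ k * (ζ ^ i)⁻¹ ≠ 1 := by
        rw [Ne, mul_inv_eq_one₀ (pow_ne_zero _ hζ0)]
        exact fun h ↦ hki (hζ.pow_inj (Finset.mem_range.mp hk) hi h)
      have hwp : (ζ ^ k * (ζ ^ i)⁻¹) ^ p = 1 := by
        rw [mul_pow, inv_pow, ← pow_mul, ← pow_mul, mul_comm k, mul_comm i, pow_mul, pow_mul,
          hζ.pow_eq_one]
        simp
      have := mul_geom_sum (ζ ^ k * (ζ ^ i)⁻¹) p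
      rw [hwp, sub_self, mul_eq_zero, or_iff_right (sub_ne_zero.2 hw1)] at this
      exact this
  have hsum : ∑ j ∈ Finset.range p, algebraMap K F ((ζ ^ i)⁻¹ ^ j) *
      ∑ k ∈ Finset.range p, algebraMap K F (ζ ^ (k * j)) * s k = algebraMap K F p * s i := by
    simp_rw [Finset.mul_sum]
    rw [Finset.sum_comm]
    have : ∀ k ∈ Finset.range p, ∑ j ∈ Finset.range p, algebraMap K F ((ζ ^ i)⁻¹ ^ j) *
        (algebraMap K F (ζ ^ (k * j)) * s k) = if k = i then algebraMap K F p * s k else 0 := by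
      intro k hk
      have h1 := congrArg (fun c ↦ algebraMap K F c * s k) (hgeom k hk)
      simp only [map_sum, Finset.sum_mul] at h1
      rw [show (if k = i then algebraMap K F p * s k else 0) =
        algebraMap K F (if k = i then (p : K) else 0) * s k by split_ifs <;> simp, ← h1]
      refine Finset.sum_congr rfl fun j _ ↦ ?_
      rw [mul_pow, ← pow_mul ζ, map_mul]
      ring
    rw [Finset.sum_congr rfl this, Finset.sum_ite_eq' (Finset.range p) i,
      if_pos (Finset.mem_range.2 hi)]
  have hmem : algebraMap K F p * s i ∈ L := by
    rw [← hsum]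
    exact sum_mem fun j hj ↦ mul_mem (L.algebraMap_mem _) (hs j (Finset.mem_range.mp hj))
  have hp' : algebraMap K F p ≠ 0 := (map_ne_zero _).2 hp
  rw [show s i = (algebraMap K F p)⁻¹ * (algebraMap K F p * s i) by
    rw [inv_mul_cancel_left₀ hp']]
  exact mul_mem (inv_mem (L.algebraMap_mem _)) hmem

/-- A vanishing sum would make Σ X_i^p the zero polynomial, yet it takes the value 1 at (1, 0, …,
0). -/
theorem sum_pow_ne_zero_of_algebraicIndependent {p : ℕ} (hp : 0 < p) {y : ℕ → F}
    (hy : AlgebraicIndependent K fun i : Fin p ↦ y i) : ∑ i ∈ Finset.range p, y i ^ p ≠ 0 := by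
  intro h
  have : NeZero p := ⟨hp.ne'⟩
  have h1 : MvPolynomial.aeval (fun i : Fin p ↦ y i)
      (∑ i : Fin p, (MvPolynomial.X i : MvPolynomial (Fin p) K) ^ p) = 0 := by
    rw [← h, Finset.sum_range]
    simp
  have h2 := congrArg (MvPolynomial.eval (Pi.single (0 : Fin p) (1 : K)))
    (hy.eq_zero_of_aeval_eq_zero _ h1)
  simp [Pi.single_apply, ite_pow, hp.ne'] at h2

/-- Multiplying by Π y_i turns the sum into a polynomial. At (0, 1, …, 1) every term with i ≠ 0
contains the factor X_0 and vanishes, and the term i = 0 leaves `c 0`. -/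
theorem sum_smul_div_ne_zero_of_algebraicIndependent {p : ℕ} (hp : 1 < p) {y : ℕ → F}
    (hy : AlgebraicIndependent K fun i : Fin p ↦ y i) {ε : K}
    (hyp : y p = algebraMap K F ε * y 0) (c : ℕ → K) (hc : c 0 ≠ 0) :
    ∑ i ∈ Finset.range p, algebraMap K F (c i) * (y (i + 1) / y i) ≠ 0 := by
  intro h
  have : NeZero p := ⟨by omega⟩
  have hy0 : ∀ i : Fin p, y i ≠ 0 := fun i ↦ hy.ne_zero i
  let Q : Fin p → MvPolynomial (Fin p) K := fun i ↦
    if hi : (i : ℕ) + 1 < p then MvPolynomial.X ⟨i + 1, hi⟩ else MvPolynomial.C ε * MvPolynomial.X 0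
  have hQ : ∀ i, MvPolynomial.aeval (fun i : Fin p ↦ y i) (Q i) = y (i + 1) := by
    intro i
    simp only [Q]
    split_ifs with hi
    · simp
    · have : (i : ℕ) + 1 = p := by omega
      simp [this, hyp]
  have h1 : MvPolynomial.aeval (fun i : Fin p ↦ y i)
      (∑ i : Fin p, MvPolynomial.C (c i) * (Q i * ∏ j ∈ Finset.univ.erase i, MvPolynomial.X j)) = 0 := by
    rw [← mul_zero (∏ i : Fin p, y i), ← h, Finset.sum_range, Finset.mul_sum, map_sum]
    refine Finset.sum_congr rfl fun i _ ↦ ?_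
    rw [map_mul, map_mul, hQ, map_prod, MvPolynomial.aeval_C,
      ← Finset.mul_prod_erase Finset.univ (fun i : Fin p ↦ y i) (Finset.mem_univ i)]
    simp only [MvPolynomial.aeval_X]
    field_simp [hy0 i]
  have h2 := congrArg (MvPolynomial.eval (fun i : Fin p ↦ if i = 0 then (0 : K) else 1))
    (hy.eq_zero_of_aeval_eq_zero _ h1)
  rw [map_sum, Finset.sum_eq_single 0] at h2
  · refine hc ?_
    have hprod : ∏ j ∈ Finset.univ.erase (0 : Fin p), (if j = 0 then (0 : K) else 1) = 1 :=
      Finset.prod_eq_one fun j hj ↦ if_neg (Finset.ne_of_mem_erase hj)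
    have hne : (⟨1, hp⟩ : Fin p) ≠ 0 := fun h ↦ by simpa using congrArg Fin.val h
    simpa [Q, hp, hprod, hne] using h2
  · intro i _ hi
    rw [map_mul, map_mul, map_prod, Finset.prod_eq_zero (Finset.mem_erase.2 ⟨hi.symm, Finset.mem_univ 0⟩)]
    · simp
    · simp
  · simp

end Monomial

section Monomial

open IntermediateField Submodule

variable {K F G : Type*} [Field K] [Field F] [Algebra K F] [Group G]

/-- Rationality of the fixed field, from a faithful `p`-dimensional monomial subrepresentation on
which one generator acts diagonally and the other by a twisted cyclic shift. -/
theorem IsRegularSystem.isRationalOver_of_monomial [Finite G] {ρ : G →* (F ≃ₐ[K] F)} {X : G → F}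
    (h : IsRegularSystem ρ X) {p : ℕ} (hp : p.Prime) (hG : Nat.card G = p ^ 3) {ζ : K}
    (hζ : IsPrimitiveRoot ζ p) (hpK : (p : K) ≠ 0) {y : ℕ → F}
    (hyind : LinearIndependent K fun i : Fin p ↦ y i) (hyV : ∀ i, y i ∈ span K (Set.range X))
    {ε : K} (hε : ε ^ p = 1) (hyp : ∀ i, y (i + p) = algebraMap K F ε * y i) {a t : G}
    (hgen : Subgroup.closure {a, t} = ⊤) (ha : ∀ i, ρ a (y i) = algebraMap K F (ζ ^ i) * y i)
    (ht : ∀ i, ρ t (y i) = y (i + 1)) (hfaith : ∀ g, (∀ i, ρ g (y i) = y i) → g = 1) :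
    IsRationalOver K (fixedField ρ.range) := by
  classical
  have hp1 : 1 < p := hp.one_lt
  have hp0 : 0 < p := hp.pos
  have hζ0 : ζ ≠ 0 := hζ.ne_zero hp0.ne'
  have hε0 : ε ≠ 0 := by rintro rfl; simp [hp0.ne'] at hε
  have hζF : ∀ i, algebraMap K F (ζ ^ i) ≠ 0 := fun i ↦ (map_ne_zero _).2 (pow_ne_zero _ hζ0)
  have hyalg := h.algebraicIndependent_of_linearIndependent (fun i : Fin p ↦ hyV i) hyind
  have hy0 : ∀ i, y i ≠ 0 := by
    intro i
    induction i using Nat.strong_induction_on with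
    | _ i ih =>
      rcases lt_or_ge i p with hi | hi
      · exact hyalg.ne_zero ⟨i, hi⟩
      · rw [← Nat.sub_add_cancel hi, hyp]
        exact mul_ne_zero ((map_ne_zero _).2 hε0) (ih _ (by omega))
  have hinv : ∀ x : F, ρ a x = x → ρ t x = x → ∀ g, ρ g x = x := by
    intro x hax htx
    refine forall_of_closure_eq_top hgen (by simp) (fun a b ha hb ↦ by simp [ha, hb]) ?_
    rintro _ (rfl | rfl) <;> assumption
  -- The ratios are all scaled by the same factor ζ under `a` and permuted cyclically by `t`: the
  -- twist `ε` cancels.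
  set u : ℕ → F := fun i ↦ y (i + 1) / y i with hu
  have hu0 : ∀ i, u i ≠ 0 := fun i ↦ div_ne_zero (hy0 _) (hy0 _)
  have hup : u p = u 0 := by
    have h0 := hyp 0
    have h1 := hyp 1
    rw [zero_add] at h0
    rw [add_comm 1 p] at h1
    simp only [hu]
    rw [h0, h1, mul_div_mul_left _ _ ((map_ne_zero _).2 hε0)]
  have hta : ∀ i, ρ t (u i) = u (i + 1) := fun i ↦ by simp [hu, ht]
  have hau : ∀ i, ρ a (u i) = algebraMap K F ζ * u i := by
    intro i
    simp only [hu, map_div₀, ha]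
    rw [pow_succ, map_mul, mul_assoc, mul_div_mul_left _ _ (hζF i), mul_div_assoc]
  have hshift : ∀ w : ℕ → F, w p = w 0 →
      ∑ i ∈ Finset.range p, w (i + 1) = ∑ i ∈ Finset.range p, w i := by
    intro w hw
    have := (Finset.sum_range_succ' w p).symm.trans (Finset.sum_range_succ w p)
    rwa [hw, add_left_inj] at this
  set S : F := ∑ i ∈ Finset.range p, u i with hS
  have hne : ∀ c : ℕ → K, c 0 ≠ 0 → ∑ i ∈ Finset.range p, algebraMap K F (c i) * u i ≠ 0 :=
    sum_smul_div_ne_zero_of_algebraicIndependent hp1 hyalg (by simpa using hyp 0)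
  have hS0 : S ≠ 0 := by simpa using hne (fun _ ↦ 1) one_ne_zero
  have htS : ρ t S = S := by simp only [hS, map_sum, hta]; exact hshift u hup
  have haS : ρ a S = algebraMap K F ζ * S := by simp only [hS, map_sum, hau, Finset.mul_sum]
  -- Dividing by the sum removes the common factor ζ, leaving only the cyclic shift.
  set s : ℕ → F := fun i ↦ u i / S with hs
  have hs0 : ∀ i, s i ≠ 0 := fun i ↦ div_ne_zero (hu0 i) hS0
  have hts : ∀ i, ρ t (s i) = s (i + 1) := fun i ↦ by simp [hs, hta, htS]
  have has : ∀ i, ρ a (s i) = s i := fun i ↦ by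
    simp only [hs, map_div₀, hau, haS]
    rw [mul_div_mul_left _ _ ((map_ne_zero _).2 hζ0)]
  have hsp : s p = s 0 := by simp only [hs, hup]
  -- The Fourier transform diagonalizes the shift: `t` multiplies `x j` by ζ^(−j), so `x j / x 1 ^
  -- j` is invariant.
  set x : ℕ → F := fun j ↦ ∑ i ∈ Finset.range p, algebraMap K F (ζ ^ (i * j)) * s i with hx
  have hax : ∀ j, ρ a (x j) = x j := fun j ↦ by
    simp only [hx, map_sum, map_mul, AlgEquiv.commutes, has]
  have htx : ∀ j, algebraMap K F (ζ ^ j) * ρ t (x j) = x j := by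
    intro j
    simp only [hx, map_sum, map_mul, AlgEquiv.commutes, hts, Finset.mul_sum]
    rw [← hshift (fun i ↦ algebraMap K F (ζ ^ (i * j)) * s i) (by
      simp [hsp, pow_mul, hζ.pow_eq_one])]
    refine Finset.sum_congr rfl fun i _ ↦ ?_
    rw [← mul_assoc, ← map_mul, ← pow_add]
    congr 3
    ring
  have htx' : ∀ j, ρ t (x j) = (algebraMap K F (ζ ^ j))⁻¹ * x j := fun j ↦ by
    rw [eq_inv_mul_iff_mul_eq₀ (hζF j), htx]
  have hx1 : x 1 ≠ 0 := by
    have := div_ne_zero (hne (fun i ↦ ζ ^ (i * 1)) (by simp)) hS0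
    rw [Finset.sum_div] at this
    simpa only [hx, hs, mul_div_assoc] using this
  set N : F := ∑ i ∈ Finset.range p, y i ^ p with hN
  have hN0 : N ≠ 0 := sum_pow_ne_zero_of_algebraicIndependent hp0 hyalg
  -- At most 1 + 1 + (p − 2) = p = dim U invariants; `x 0 = 1` needs no generator.
  set f : Finset F := insert (x 1 ^ p) (insert N
    ((Finset.Ico 2 p).image fun j ↦ x j / x 1 ^ j)) with hf
  set U : Submodule K F := span K (Set.range fun i : Fin p ↦ y i) with hU
  have hyU : ∀ i, y i ∈ U := by
    intro i
    induction i using Nat.strong_induction_on with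
    | _ i ih =>
      rcases lt_or_ge i p with hi | hi
      · exact subset_span ⟨⟨i, hi⟩, rfl⟩
      · rw [← Nat.sub_add_cancel hi, hyp, ← Algebra.smul_def]
        exact U.smul_mem _ (ih _ (by omega))
  -- The three radicals: `x 1` gives all `x j` and hence all `s i`; `u 0` then gives all `u i`, so
  -- all ratios `y i / y 0`; `y 0` finally gives the `y i`.
  refine h.isRationalOver_of_subrepresentation U (span_le.2 (Set.range_subset_iff.2 fun i ↦ hyV i))
    ?_ ?_ (fun g hg ↦ hfaith g fun i ↦ hg _ (hyU i)) hp0 hG f ?_ ?_ (x 1) (u 0) (y 0) ?_ ?_ ?_ ?_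
  · refine forall_of_closure_eq_top hgen (by simp) (fun a b ha hb u hu ↦ ?_) ?_
    · rw [map_mul, AlgEquiv.mul_apply]
      exact ha _ (hb u hu)
    · intro g hg
      have : U ≤ U.comap (ρ g).toLinearMap := by
        refine span_le.2 (Set.range_subset_iff.2 fun i ↦ ?_)
        change ρ g (y i) ∈ U
        obtain rfl | rfl := hg
        · rw [ha, ← Algebra.smul_def]
          exact U.smul_mem _ (hyU i)
        · rw [ht]
          exact hyU _
      exact this
  · exact fun hbot ↦ hy0 0 (by simpa [hbot] using hyU 0)
  · rw [finrank_span_eq_card hyind, Fintype.card_fin]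
    refine (Finset.card_insert_le _ _).trans ?_
    refine (Nat.succ_le_succ (Finset.card_insert_le _ _)).trans ?_
    have := Finset.card_image_le (s := Finset.Ico 2 p) (f := fun j ↦ x j / x 1 ^ j)
    rw [Nat.card_Ico] at this
    omega
  · intro w hw
    simp only [hf, Finset.mem_insert, Finset.mem_image] at hw
    obtain rfl | rfl | ⟨j, -, rfl⟩ := hw
    · refine hinv _ (by rw [map_pow, hax]) ?_
      rw [map_pow, htx', mul_pow, inv_pow, ← map_pow, pow_one, hζ.pow_eq_one]
      simp
    · refine hinv _ ?_ ?_
      · rw [hN, map_sum]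
        refine Finset.sum_congr rfl fun i _ ↦ ?_
        rw [map_pow, ha, mul_pow, ← map_pow, pow_right_comm, hζ.pow_eq_one]
        simp
      · rw [hN, map_sum]
        simp only [map_pow, ht]
        refine hshift (fun i ↦ y i ^ p) ?_
        have := hyp 0
        rw [zero_add] at this
        rw [this, mul_pow, ← map_pow, hε, map_one, one_mul]
    · refine hinv _ (by rw [map_div₀, map_pow, hax, hax]) ?_
      rw [map_div₀, map_pow, htx', htx', mul_pow, inv_pow, ← map_pow, pow_one,
        mul_div_mul_left _ _ (inv_ne_zero (hζF j))]
  · exact subset_adjoin K _ (by simp [hf])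
  all_goals
    set L₁ := adjoin K (insert (x 1) (f : Set F)) with hL₁
    have hfL₁ : ∀ w ∈ f, w ∈ L₁ := fun w hw ↦ subset_adjoin K _ (Or.inr hw)
    have hx1L : x 1 ∈ L₁ := subset_adjoin K _ (Or.inl rfl)
    have hxL : ∀ j < p, x j ∈ L₁ := by
      intro j hj
      obtain rfl | rfl | hj2 : j = 0 ∨ j = 1 ∨ 2 ≤ j := by omega
      · have : x 0 = 1 := by
          simp only [hx, hs, mul_zero, pow_zero, map_one, one_mul]
          rw [← Finset.sum_div, div_self hS0]
        rw [this]
        exact one_mem _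
      · exact hx1L
      · rw [← div_mul_cancel₀ (x j) (pow_ne_zero j hx1)]
        refine mul_mem (hfL₁ _ ?_) (pow_mem hx1L j)
        simp only [hf, Finset.mem_insert, Finset.mem_image, Finset.mem_Ico]
        exact Or.inr (Or.inr ⟨j, ⟨hj2, hj⟩, rfl⟩)
    have hsL : ∀ i < p, s i ∈ L₁ := mem_of_fourier_mem L₁ hζ hpK s hxL
    have hus : ∀ i, u i = u 0 * (s i / s 0) := by
      intro i
      have := hu0 0
      simp only [hs]
      field_simp
  -- The product telescopes to y_p / y_0 = ε. Since u_i = u_0 · s_i / s_0, this determines u_0^p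
  -- from the `s i`.
  · have hprod : ∏ i ∈ Finset.range p, u i = algebraMap K F ε := by
      have : ∀ n, ∏ i ∈ Finset.range n, u i = y n / y 0 := by
        intro n
        induction n with
        | zero => simp [hy0]
        | succ n ih => rw [Finset.prod_range_succ, ih, div_mul_div_cancel₀' (hy0 n)]
      have h0 := hyp 0
      rw [zero_add] at h0
      rw [this, h0, mul_div_cancel_right₀ _ (hy0 0)]
    have h2 : u 0 ^ p * ∏ i ∈ Finset.range p, s i / s 0 = algebraMap K F ε := by
      rw [← hprod, Finset.prod_congr rfl fun i _ ↦ hus i, Finset.prod_mul_distrib]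
      simp
    rw [eq_div_of_mul_eq (Finset.prod_ne_zero_iff.2 fun i _ ↦ div_ne_zero (hs0 i) (hs0 0)) h2]
    exact div_mem (L₁.algebraMap_mem _) (prod_mem fun i hi ↦
      div_mem (hsL i (Finset.mem_range.mp hi)) (hsL 0 hp0))
  all_goals
    set L₂ := adjoin K (insert (u 0) (insert (x 1) (f : Set F))) with hL₂
    have hL₁₂ : L₁ ≤ L₂ := adjoin.mono _ _ _ (Set.subset_insert _ _)
    have huL : ∀ i < p, u i ∈ L₂ := fun i hi ↦ by
      rw [hus]
      exact mul_mem (subset_adjoin K _ (Or.inl rfl)) (hL₁₂ (div_mem (hsL i hi) (hsL 0 hp0)))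
    have hyL : ∀ i < p, y i / y 0 ∈ L₂ := by
      intro i
      induction i with
      | zero => intro _; rw [div_self (hy0 0)]; exact one_mem _
      | succ i ih =>
        intro hi
        rw [show y (i + 1) / y 0 = u i * (y i / y 0) from (div_mul_div_cancel₀ (hy0 i)).symm]
        exact mul_mem (huL i (by omega)) (ih (by omega))
  -- `N` is homogeneous of degree p, so it equals y_0^p times a function of the known ratios.
  · have h3 : y 0 ^ p * ∑ i ∈ Finset.range p, (y i / y 0) ^ p = N := by
      rw [hN, Finset.mul_sum]
      refine Finset.sum_congr rfl fun i _ ↦ ?_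
      rw [← mul_pow, mul_div_cancel₀ _ (hy0 0)]
    have h4 : ∑ i ∈ Finset.range p, (y i / y 0) ^ p ≠ 0 := by
      intro h4
      rw [h4, mul_zero] at h3
      exact hN0 h3.symm
    rw [eq_div_of_mul_eq h4 h3]
    exact div_mem (hL₁₂ (hfL₁ _ (by simp [hf])))
      (sum_mem fun i hi ↦ pow_mem (hyL i (Finset.mem_range.mp hi)) p)
  · set L₃ := adjoin K (insert (y 0) (insert (u 0) (insert (x 1) (f : Set F)))) with hL₃
    have hL₂₃ : L₂ ≤ L₃ := adjoin.mono _ _ _ (Set.subset_insert _ _)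
    have : U ≤ L₃.toSubalgebra.toSubmodule := by
      refine span_le.2 (Set.range_subset_iff.2 fun i ↦ ?_)
      change y i ∈ L₃
      rw [← div_mul_cancel₀ (y i) (hy0 0)]
      exact mul_mem (hL₂₃ (hyL i i.2)) (subset_adjoin K _ (Or.inl rfl))
    exact this

end Monomial

/-! ### Invariants of the quaternion representation -/

section Quaternion

open IntermediateField Submodule

variable {K F G : Type*} [Field K] [Field F] [Algebra K F] [Group G]

/-- Rationality of the fixed field, from a faithful four-dimensional subrepresentation on which
two generators act as left multiplication by the quaternions `i` and `j`. The invariants describe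
the rotation attached to the quaternion `w + xi + yj + zk`. -/
theorem IsRegularSystem.isRationalOver_of_quaternion [Finite G] {ρ : G →* (F ≃ₐ[K] F)} {X : G → F}
    (h : IsRegularSystem ρ X) (hG : Nat.card G = 2 ^ 3) (h2 : (2 : K) ≠ 0) {w x y z : F}
    (hind : LinearIndependent K ![w, x, y, z])
    (hV : ∀ i, ![w, x, y, z] i ∈ span K (Set.range X)) {a b : G}
    (hgen : Subgroup.closure {a, b} = ⊤)
    (haw : ρ a w = x) (hax : ρ a x = -w) (hay : ρ a y = z) (haz : ρ a z = -y)
    (hbw : ρ b w = y) (hbx : ρ b x = -z) (hby : ρ b y = -w) (hbz : ρ b z = x)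
    (hfaith : ∀ g, ρ g w = w → ρ g x = x → ρ g y = y → g = 1) :
    IsRationalOver K (fixedField ρ.range) := by
  classical
  have hinv : ∀ v : F, ρ a v = v → ρ b v = v → ∀ g, ρ g v = v := by
    intro v hav hbv
    refine forall_of_closure_eq_top hgen (by simp) (fun a b ha hb ↦ by simp [ha, hb]) ?_
    rintro _ (rfl | rfl) <;> assumption
  have halg := h.algebraicIndependent_of_linearIndependent hV hind
  have hne : ∀ (P : MvPolynomial (Fin 4) K) (c : Fin 4 → K), MvPolynomial.eval c P ≠ 0 →
      MvPolynomial.aeval ![w, x, y, z] P ≠ 0 := fun P c hP h0 ↦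
    hP (by rw [halg.eq_zero_of_aeval_eq_zero P h0, map_zero])
  -- The `aᵢ` and `bᵢ` are n times the first two rows of the rotation matrix. Each generator fixes
  -- one of these rows and negates the other, so ratios within a row are invariant.
  set n := w ^ 2 + x ^ 2 + y ^ 2 + z ^ 2 with hn
  set a₁ := w ^ 2 + x ^ 2 - y ^ 2 - z ^ 2 with ha₁
  set a₂ := 2 * (x * y - w * z) with ha₂
  set a₃ := 2 * (x * z + w * y) with ha₃
  set b₁ := 2 * (x * y + w * z) with hb₁
  set b₂ := w ^ 2 - x ^ 2 + y ^ 2 - z ^ 2 with hb₂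
  set b₃ := 2 * (y * z - w * x) with hb₃
  have hw0 : w ≠ 0 := halg.ne_zero 0
  have h2F : (2 : F) ≠ 0 := by
    rw [← map_ofNat (algebraMap K F) 2]
    exact (map_ne_zero _).2 h2
  have hn0 : n ≠ 0 := by
    have := hne (.X 0 ^ 2 + .X 1 ^ 2 + .X 2 ^ 2 + .X 3 ^ 2) ![1, 0, 0, 0] (by simp)
    simp only [map_add, map_pow, MvPolynomial.aeval_X] at this
    exact this
  have ha₁0 : a₁ ≠ 0 := by
    have := hne (.X 0 ^ 2 + .X 1 ^ 2 - .X 2 ^ 2 - .X 3 ^ 2) ![1, 0, 0, 0] (by simp)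
    simp only [map_add, map_sub, map_pow, MvPolynomial.aeval_X] at this
    exact this
  have ha₃0 : a₃ ≠ 0 := mul_ne_zero h2F (by
    simpa using hne (.X 1 * .X 3 + .X 0 * .X 2) ![0, 1, 0, 1] (by simp))
  have hb₁0 : b₁ ≠ 0 := mul_ne_zero h2F (by
    simpa using hne (.X 1 * .X 2 + .X 0 * .X 3) ![1, 0, 0, 1] (by simp))
  have hρ2 : ∀ g, ρ g 2 = 2 := fun g ↦ map_ofNat _ 2
  have han : ρ a n = n := by
    simp only [hn, map_add, map_pow, haw, hax, hay, haz]; ring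
  have hbn : ρ b n = n := by
    simp only [hn, map_add, map_pow, hbw, hbx, hby, hbz]; ring
  have haa₁ : ρ a a₁ = a₁ := by
    simp only [ha₁, map_add, map_sub, map_pow, haw, hax, hay, haz]; ring
  have hba₁ : ρ b a₁ = -a₁ := by
    simp only [ha₁, map_add, map_sub, map_pow, hbw, hbx, hby, hbz]; ring
  have haa₂ : ρ a a₂ = a₂ := by
    simp only [ha₂, map_mul, map_sub, hρ2, haw, hax, hay, haz]; ring
  have hba₂ : ρ b a₂ = -a₂ := by
    simp only [ha₂, map_mul, map_sub, hρ2, hbw, hbx, hby, hbz]; ring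
  have haa₃ : ρ a a₃ = a₃ := by
    simp only [ha₃, map_mul, map_add, hρ2, haw, hax, hay, haz]; ring
  have hba₃ : ρ b a₃ = -a₃ := by
    simp only [ha₃, map_mul, map_add, hρ2, hbw, hbx, hby, hbz]; ring
  have hab₁ : ρ a b₁ = -b₁ := by
    simp only [hb₁, map_mul, map_add, hρ2, haw, hax, hay, haz]; ring
  have hbb₁ : ρ b b₁ = b₁ := by
    simp only [hb₁, map_mul, map_add, hρ2, hbw, hbx, hby, hbz]; ring
  have hab₂ : ρ a b₂ = -b₂ := by
    simp only [hb₂, map_add, map_sub, map_pow, haw, hax, hay, haz]; ring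
  have hbb₂ : ρ b b₂ = b₂ := by
    simp only [hb₂, map_add, map_sub, map_pow, hbw, hbx, hby, hbz]; ring
  have hnorm_a : (a₁ / n) ^ 2 * (1 + (a₂ / a₁) ^ 2 + (a₃ / a₁) ^ 2) = 1 := by
    field_simp
    simp only [hn, ha₁, ha₂, ha₃]
    ring
  -- Orthogonality of the two rows; this is why `b₃ / b₁` is not needed among the generators.
  have horth : b₃ / b₁ = -(1 + a₂ / a₁ * (b₂ / b₁)) / (a₃ / a₁) := by
    field_simp
    simp only [ha₁, ha₂, ha₃, hb₁, hb₂, hb₃]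
    ring
  have hnorm_b : (b₁ / n) ^ 2 * (1 + (b₂ / b₁) ^ 2 + (b₃ / b₁) ^ 2) = 1 := by
    field_simp
    simp only [hn, hb₁, hb₂, hb₃]
    ring
  set f : Finset F := {a₂ / a₁, a₃ / a₁, b₂ / b₁, n} with hf
  set U : Submodule K F := span K (Set.range ![w, x, y, z]) with hU
  have hwU : w ∈ U := subset_span ⟨0, rfl⟩
  have hxU : x ∈ U := subset_span ⟨1, rfl⟩
  have hyU : y ∈ U := subset_span ⟨2, rfl⟩
  have hzU : z ∈ U := subset_span ⟨3, rfl⟩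
  have hU_le : ∀ W : Submodule K F, w ∈ W → x ∈ W → y ∈ W → z ∈ W → U ≤ W := by
    intro W hw hx hy hz
    refine span_le.2 (Set.range_subset_iff.2 fun i ↦ ?_)
    fin_cases i <;> assumption
  refine h.isRationalOver_of_subrepresentation U (span_le.2 (Set.range_subset_iff.2 hV))
    ?_ ?_ (fun g hg ↦ hfaith g (hg w hwU) (hg x hxU) (hg y hyU)) two_pos hG f ?_ ?_ (a₁ / n) (b₁ / n) w
    ?_ ?_ ?_ ?_
  · refine forall_of_closure_eq_top hgen (by simp) (fun a b ha hb u hu ↦ ?_) ?_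
    · rw [map_mul, AlgEquiv.mul_apply]
      exact ha _ (hb u hu)
    · intro g hg
      have : U ≤ U.comap (ρ g).toLinearMap := by
        obtain rfl | rfl := hg
        · apply hU_le <;> simp only [mem_comap, AlgEquiv.toLinearMap_apply, neg_mem_iff, haw, hax,
            hay, haz, hwU, hxU, hyU, hzU]
        · apply hU_le <;> simp only [mem_comap, AlgEquiv.toLinearMap_apply, neg_mem_iff, hbw, hbx,
            hby, hbz, hwU, hxU, hyU, hzU]
      exact this
  · exact fun hbot ↦ hw0 (by simpa [hbot] using hwU)
  · rw [finrank_span_eq_card hind, Fintype.card_fin]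
    exact Finset.card_le_four
  · intro v hv
    simp only [hf, Finset.mem_insert, Finset.mem_singleton] at hv
    obtain rfl | rfl | rfl | rfl := hv
    · exact hinv _ (by rw [map_div₀, haa₁, haa₂]) (by rw [map_div₀, hba₁, hba₂, neg_div_neg_eq])
    · exact hinv _ (by rw [map_div₀, haa₁, haa₃]) (by rw [map_div₀, hba₁, hba₃, neg_div_neg_eq])
    · exact hinv _ (by rw [map_div₀, hab₁, hab₂, neg_div_neg_eq]) (by rw [map_div₀, hbb₁, hbb₂])
    · exact hinv _ han hbn
  all_goals
    have hα : a₂ / a₁ ∈ adjoin K (f : Set F) := subset_adjoin K _ (by simp [hf])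
    have hα' : a₃ / a₁ ∈ adjoin K (f : Set F) := subset_adjoin K _ (by simp [hf])
    have hβ : b₂ / b₁ ∈ adjoin K (f : Set F) := subset_adjoin K _ (by simp [hf])
    have hnf : n ∈ adjoin K (f : Set F) := subset_adjoin K _ (by simp [hf])
    have hβ' : b₃ / b₁ ∈ adjoin K (f : Set F) := by
      rw [horth]
      exact div_mem (neg_mem (add_mem (one_mem _) (mul_mem hα hβ))) hα'
  · rw [eq_inv_of_mul_eq_one_left hnorm_a]
    exact inv_mem (add_mem (add_mem (one_mem _) (pow_mem hα 2)) (pow_mem hα' 2))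
  all_goals
    set L₁ := adjoin K (insert (a₁ / n) (f : Set F))
    have hfL₁ : adjoin K (f : Set F) ≤ L₁ := adjoin.mono _ _ _ (Set.subset_insert _ _)
  · rw [eq_inv_of_mul_eq_one_left hnorm_b]
    exact hfL₁ (inv_mem (add_mem (add_mem (one_mem _) (pow_mem hβ 2)) (pow_mem hβ' 2)))
  all_goals
    set L₂ := adjoin K (insert (b₁ / n) (insert (a₁ / n) (f : Set F)))
    have hL₁₂ : L₁ ≤ L₂ := adjoin.mono _ _ _ (Set.subset_insert _ _)
    have hfL₂ := hfL₁.trans hL₁₂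
    have hA₁ : a₁ / n ∈ L₂ := subset_adjoin K _ (Or.inr (Or.inl rfl))
    have hB₁ : b₁ / n ∈ L₂ := subset_adjoin K _ (Or.inl rfl)
    have hA₂ : a₂ / n ∈ L₂ := by
      rw [← div_mul_div_cancel₀ ha₁0]; exact mul_mem (hfL₂ hα) hA₁
    have hA₃ : a₃ / n ∈ L₂ := by
      rw [← div_mul_div_cancel₀ ha₁0]; exact mul_mem (hfL₂ hα') hA₁
    have hB₂ : b₂ / n ∈ L₂ := by
      rw [← div_mul_div_cancel₀ hb₁0]; exact mul_mem (hfL₂ hβ) hB₁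
    have hB₃ : b₃ / n ∈ L₂ := by
      rw [← div_mul_div_cancel₀ hb₁0]; exact mul_mem (hfL₂ hβ') hB₁
    -- The third row of a rotation matrix is the cross product of the first two.
    have hC₁ : a₂ / n * (b₃ / n) - a₃ / n * (b₂ / n) ∈ L₂ :=
      sub_mem (mul_mem hA₂ hB₃) (mul_mem hA₃ hB₂)
    have hC₂ : a₃ / n * (b₁ / n) - a₁ / n * (b₃ / n) ∈ L₂ :=
      sub_mem (mul_mem hA₃ hB₁) (mul_mem hA₁ hB₃)
    have hC₃ : a₁ / n * (b₂ / n) - a₂ / n * (b₁ / n) ∈ L₂ :=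
      sub_mem (mul_mem hA₁ hB₂) (mul_mem hA₂ hB₁)
    have hC₁' : a₂ / n * (b₃ / n) - a₃ / n * (b₂ / n) = 2 * (x * z - w * y) / n := by
      field_simp
      simp only [hn, ha₂, ha₃, hb₂, hb₃]
      ring
    have hC₂' : a₃ / n * (b₁ / n) - a₁ / n * (b₃ / n) = 2 * (y * z + w * x) / n := by
      field_simp
      simp only [hn, ha₁, ha₃, hb₁, hb₃]
      ring
    have hC₃' : a₁ / n * (b₂ / n) - a₂ / n * (b₁ / n) =
        (w ^ 2 - x ^ 2 - y ^ 2 + z ^ 2) / n := by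
      field_simp
      simp only [hn, ha₁, ha₂, hb₁, hb₂]
      ring
    rw [hC₁'] at hC₁
    rw [hC₂'] at hC₂
    rw [hC₃'] at hC₃
    -- One plus the trace; together with the antisymmetric part of the matrix it recovers x/w, y/w
    -- and z/w.
    have hT : 1 + a₁ / n + b₂ / n + (w ^ 2 - x ^ 2 - y ^ 2 + z ^ 2) / n = 4 * w ^ 2 / n := by
      field_simp
      simp only [hn, ha₁, hb₂]
      ring
    have hTL : 4 * w ^ 2 / n ∈ L₂ := by
      rw [← hT]
      exact add_mem (add_mem (add_mem (one_mem _) hA₁) hB₂) hC₃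
    have h4 : (4 : F) ≠ 0 := by
      rw [show (4 : F) = 2 * 2 by norm_num]
      exact mul_ne_zero h2F h2F
    have hxw : x / w ∈ L₂ := by
      have : x / w = (2 * (y * z + w * x) / n - b₃ / n) / (4 * w ^ 2 / n) := by
        field_simp
        simp only [hb₃]
        ring
      rw [this]
      exact div_mem (sub_mem hC₂ hB₃) hTL
    have hyw : y / w ∈ L₂ := by
      have : y / w = (a₃ / n - 2 * (x * z - w * y) / n) / (4 * w ^ 2 / n) := by
        field_simp
        simp only [ha₃]
        ring
      rw [this]
      exact div_mem (sub_mem hA₃ hC₁) hTL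
    have hzw : z / w ∈ L₂ := by
      have : z / w = (b₁ / n - a₂ / n) / (4 * w ^ 2 / n) := by
        field_simp
        simp only [hb₁, ha₂]
        ring
      rw [this]
      exact div_mem (sub_mem hB₁ hA₂) hTL
  · have h3 : w ^ 2 * (1 + (x / w) ^ 2 + (y / w) ^ 2 + (z / w) ^ 2) = n := by
      field_simp
      simp only [hn]
    have h5 : 1 + (x / w) ^ 2 + (y / w) ^ 2 + (z / w) ^ 2 ≠ 0 := by
      intro h5
      rw [h5, mul_zero] at h3
      exact hn0 h3.symm
    rw [eq_div_of_mul_eq h5 h3]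
    exact div_mem (hfL₂ hnf) (add_mem (add_mem (add_mem (one_mem _) (pow_mem hxw 2))
      (pow_mem hyw 2)) (pow_mem hzw 2))
  · set L₃ := adjoin K (insert w (insert (b₁ / n) (insert (a₁ / n) (f : Set F))))
    have hL₂₃ : L₂ ≤ L₃ := adjoin.mono _ _ _ (Set.subset_insert _ _)
    have hwL : w ∈ L₃ := subset_adjoin K _ (Or.inl rfl)
    have hmul : ∀ v, v / w ∈ L₂ → v ∈ L₃ := fun v hv ↦ by
      rw [← div_mul_cancel₀ v hw0]
      exact mul_mem (hL₂₃ hv) hwL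
    have : U ≤ L₃.toSubalgebra.toSubmodule :=
      hU_le _ hwL (hmul x hxw) (hmul y hyw) (hmul z hzw)
    exact this

end Quaternion

/-! ### Structure of nonabelian groups of order p³ -/

section GroupTheory

open Subgroup

variable {G : Type*} [Group G]

/-- Each exchange of a y with an x costs one factor c. For odd p the exponent p(p − 1)/2 is
divisible by p, which makes the p-th power map multiplicative. -/
theorem mul_pow_of_commutator_central {x y c : G} (hc : ∀ g, c * g = g * c)
    (hyx : y * x = c * (x * y)) (n : ℕ) : (x * y) ^ n = c ^ n.choose 2 * (x ^ n * y ^ n) := by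
  have hcn : ∀ (k : ℕ) g, Commute (c ^ k) g := fun k g ↦ Commute.pow_left (hc g) k
  have hy : ∀ n : ℕ, y ^ n * x = c ^ n * (x * y ^ n) := by
    intro n
    induction n with
    | zero => simp
    | succ n ih =>
      rw [pow_succ', mul_assoc, ih, ← mul_assoc, ← (hcn n y).eq, mul_assoc, ← mul_assoc y, hyx,
        pow_succ]
      simp only [mul_assoc]
  induction n with
  | zero => simp
  | succ n ih =>
    rw [pow_succ, ih, Nat.choose_succ_succ', Nat.choose_one_right, pow_add, pow_succ x, pow_succ y]
    calc c ^ n.choose 2 * (x ^ n * y ^ n) * (x * y)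
        = c ^ n.choose 2 * (x ^ n * (y ^ n * x)) * y := by simp only [mul_assoc]
      _ = c ^ n.choose 2 * ((x ^ n * c ^ n) * (x * y ^ n)) * y := by rw [hy]; simp only [mul_assoc]
      _ = _ := by
        rw [← (hcn n (x ^ n)).eq, (Commute.pow_pow_self c n (n.choose 2)).eq]
        simp only [mul_assoc]

theorem not_isCyclic_quotient_center (hnonab : ¬ ∀ a b : G, a * b = b * a) :
    ¬ IsCyclic (G ⧸ center G) := fun _ ↦
  hnonab (MonoidHom.isMulCommutative_of_isCyclic_of_ker_le_center (QuotientGroup.mk' (center G))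
    (by simp)).is_comm.comm

/-- The center of a p-group is nontrivial, and an index of p or 1 would make the quotient by the
center cyclic, hence the group abelian. -/
theorem card_center_of_card_eq_prime_cube {p : ℕ} (hp : p.Prime) (hcard : Nat.card G = p ^ 3)
    (hnonab : ¬ ∀ a b : G, a * b = b * a) : Nat.card (center G) = p := by
  have := Fact.mk hp
  obtain ⟨k, hk0, hk⟩ := IsPGroup.card_center_eq_prime_pow hcard (by norm_num)
  have hmul := (center G).card_eq_card_quotient_mul_card_subgroup
  rw [hcard, hk] at hmul
  have hk3 : k ≤ 3 := (Nat.pow_dvd_pow_iff_le_right hp.one_lt).mp (Dvd.intro_left _ hmul.symm)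
  have hq : Nat.card (G ⧸ center G) = p ^ (3 - k) := by
    apply Nat.eq_of_mul_eq_mul_right (pow_pos hp.pos k)
    rw [← hmul, ← pow_add, Nat.sub_add_cancel hk3]
  obtain rfl | rfl | rfl : k = 1 ∨ k = 2 ∨ k = 3 := by omega
  · rw [hk, pow_one]
  · exact absurd (isCyclic_of_prime_card (p := p) (by simpa using hq))
      (not_isCyclic_quotient_center hnonab)
  · have : Subsingleton (G ⧸ center G) := (Nat.card_eq_one_iff_unique.mp (by simpa using hq)).1
    exact absurd isCyclic_of_subsingleton (not_isCyclic_quotient_center hnonab)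

theorem card_quotient_center {p : ℕ} (hp : p.Prime) (hcard : Nat.card G = p ^ 3)
    (hnonab : ¬ ∀ a b : G, a * b = b * a) : Nat.card (G ⧸ center G) = p ^ 2 := by
  have hmul := (center G).card_eq_card_quotient_mul_card_subgroup
  rw [hcard, card_center_of_card_eq_prime_cube hp hcard hnonab] at hmul
  apply Nat.eq_of_mul_eq_mul_right hp.pos
  rw [← hmul]
  ring

theorem commutator_mem_center {p : ℕ} (hp : p.Prime) (hcard : Nat.card G = p ^ 3)
    (hnonab : ¬ ∀ a b : G, a * b = b * a) (a b : G) : a * b * a⁻¹ * b⁻¹ ∈ center G := by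
  have := Fact.mk hp
  have h := (IsPGroup.isMulCommutative_of_card_eq_prime_sq
    (card_quotient_center hp hcard hnonab)).is_comm.comm (a : G ⧸ center G) b
  rw [← QuotientGroup.eq_one_iff]
  simp only [QuotientGroup.mk_mul, QuotientGroup.mk_inv]
  rw [h]
  group

theorem pow_prime_mem_center {p : ℕ} (hp : p.Prime) (hcard : Nat.card G = p ^ 3)
    (hnonab : ¬ ∀ a b : G, a * b = b * a) (a : G) : a ^ p ∈ center G := by
  have := Fact.mk hp
  have hq := card_quotient_center hp hcard hnonab
  have : Finite (G ⧸ center G) := Nat.finite_of_card_ne_zero (by rw [hq]; exact (pow_pos hp.pos 2).ne')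
  rw [← QuotientGroup.eq_one_iff, QuotientGroup.mk_pow, ← orderOf_dvd_iff_pow_eq_one]
  have hdvd := orderOf_dvd_natCard (a : G ⧸ center G)
  rw [hq] at hdvd
  obtain ⟨k, hk, hk'⟩ := (Nat.dvd_prime_pow hp).mp hdvd
  have hk2 : k ≠ 2 := by
    rintro rfl
    exact not_isCyclic_quotient_center hnonab
      (isCyclic_of_orderOf_eq_card (a : G ⧸ center G) (hk'.trans hq.symm))
  rw [hk']
  exact (pow_dvd_pow p (show k ≤ 1 by omega)).trans (by simp)

theorem exists_pow_eq_of_mem_center {p : ℕ} (hp : p.Prime) (hcard : Nat.card G = p ^ 3)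
    (hnonab : ¬ ∀ a b : G, a * b = b * a) {z : G} (hz : z ∈ center G) (hz1 : z ≠ 1) {g : G}
    (hg : g ∈ center G) : ∃ k : ℕ, z ^ k = g := by
  have := Fact.mk hp
  obtain ⟨k, hk⟩ := mem_powers_of_prime_card (g := (⟨z, hz⟩ : center G)) (g' := ⟨g, hg⟩)
    (card_center_of_card_eq_prime_cube hp hcard hnonab) (fun h ↦ hz1 (congrArg Subtype.val h))
  exact ⟨k, congrArg Subtype.val hk⟩

theorem pow_prime_eq_one_of_mem_center {p : ℕ} (hp : p.Prime) (hcard : Nat.card G = p ^ 3)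
    (hnonab : ¬ ∀ a b : G, a * b = b * a) {z : G} (hz : z ∈ center G) : z ^ p = 1 := by
  have := pow_card_eq_one' (x := (⟨z, hz⟩ : center G))
  rw [card_center_of_card_eq_prime_cube hp hcard hnonab] at this
  exact congrArg Subtype.val this

/-- A proper subgroup has order dividing p², so it is abelian and cannot contain two noncommuting
elements. -/
theorem closure_pair_eq_top {p : ℕ} (hp : p.Prime) (hcard : Nat.card G = p ^ 3)
    {a b : G} (hab : a * b ≠ b * a) : closure {a, b} = ⊤ := by
  have := Fact.mk hp
  have : Finite G := Nat.finite_of_card_ne_zero (by rw [hcard]; exact (pow_pos hp.pos 3).ne')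
  set H := closure {a, b} with hH
  have ha : a ∈ H := subset_closure (by simp)
  have hb : b ∈ H := subset_closure (by simp)
  have hcomm : ¬ ∀ x y : H, x * y = y * x := fun h ↦
    hab (congrArg Subtype.val (h ⟨a, ha⟩ ⟨b, hb⟩))
  have hdvd := H.card_subgroup_dvd_card
  rw [hcard] at hdvd
  obtain ⟨k, hk, hk'⟩ := (Nat.dvd_prime_pow hp).mp hdvd
  obtain rfl | rfl | rfl | rfl : k = 0 ∨ k = 1 ∨ k = 2 ∨ k = 3 := by omega
  · have : Subsingleton H := (Nat.card_eq_one_iff_unique.mp (by simpa using hk')).1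
    exact absurd (fun x y ↦ Subsingleton.elim _ _) hcomm
  · have : IsCyclic H := isCyclic_of_prime_card (p := p) (by simpa using hk')
    exact absurd (fun x y ↦ IsCyclic.commGroup.mul_comm x y) hcomm
  · exact absurd (IsPGroup.isMulCommutative_of_card_eq_prime_sq hk').is_comm.comm hcomm
  · exact H.eq_top_of_card_eq (hk'.trans hcard.symm)

/-- For odd `p` the `p`-th power map is a homomorphism into the center, so its kernel contains
noncentral elements. -/
theorem exists_noncentral_pow_prime_eq_one {p : ℕ} (hp : p.Prime) (hcard : Nat.card G = p ^ 3)
    (hnonab : ¬ ∀ a b : G, a * b = b * a) (hp2 : p ≠ 2) : ∃ a, a ∉ center G ∧ a ^ p = 1 := by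
  have : Finite G := Nat.finite_of_card_ne_zero (by rw [hcard]; exact (pow_pos hp.pos 3).ne')
  have hdvd : p ∣ p.choose 2 := hp.dvd_choose_self two_ne_zero (by have := hp.two_le; omega)
  let φ : G →* center G :=
    { toFun := fun a ↦ ⟨a ^ p, pow_prime_mem_center hp hcard hnonab a⟩
      map_one' := Subtype.ext (one_pow p)
      map_mul' := fun x y ↦ Subtype.ext (by
        have hc := commutator_mem_center hp hcard hnonab y x
        obtain ⟨m, hm⟩ := hdvd
        have := mul_pow_of_commutator_central (x := x) (y := y)
          (fun g ↦ (mem_center_iff.mp hc g).symm) (by group) p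
        rw [hm, pow_mul, pow_prime_eq_one_of_mem_center hp hcard hnonab hc, one_pow, one_mul] at this
        exact this) }
  -- Otherwise the kernel of `φ` is central, so kernel and image both have order at most p, giving
  -- p³ ≤ p².
  by_contra! hcon
  have hker : φ.ker ≤ center G := fun a ha ↦ by
    by_contra hac
    exact hcon a hac (congrArg Subtype.val ha)
  have h1 := Subgroup.card_le_of_le hker
  have h2 := φ.ker.card_eq_card_quotient_mul_card_subgroup
  have h3 : Nat.card (G ⧸ φ.ker) ≤ Nat.card (center G) :=
    Nat.card_le_card_of_injective _ (QuotientGroup.kerLift_injective φ)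
  rw [card_center_of_card_eq_prime_cube hp hcard hnonab] at h1 h3
  have h4 := Nat.mul_le_mul h3 h1
  rw [← h2, hcard] at h4
  have := hp.two_le
  nlinarith [pow_pos hp.pos 2, pow_pos hp.pos 3, pow_succ p 2]

end GroupTheory

/-! ### Finding the subrepresentations inside the regular one -/

section Assembly

open IntermediateField Submodule

variable {K F G : Type*} [Field K] [Field F] [Algebra K F] [Group G]

/-- If the center acts on a vector by a faithful character, an element fixing that vector and its
images under two generators is trivial. -/
theorem eq_one_of_fixes {ρ : G →* (F ≃ₐ[K] F)} {p : ℕ} {ζ : K} (hζ : IsPrimitiveRoot ζ p)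
    {z a b : G} (hz : z ^ p = 1)
    (hcen : ∀ g ∈ Subgroup.center G, ∃ k : ℕ, z ^ k = g)
    (hcomm : ∀ g h : G, g * h * g⁻¹ * h⁻¹ ∈ Subgroup.center G)
    (hgen : Subgroup.closure {a, b} = ⊤) {v : F} (hv : v ≠ 0)
    (hzv : ρ z v = algebraMap K F ζ * v) {g : G} (hgv : ρ g v = v)
    (hga : ρ g (ρ a v) = ρ a v) (hgb : ρ g (ρ b v) = ρ b v) : g = 1 := by
  have hpow : ∀ k : ℕ, ρ (z ^ k) v = algebraMap K F (ζ ^ k) * v := by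
    intro k
    induction k with
    | zero => simp
    | succ k ih =>
      rw [pow_succ, map_mul, AlgEquiv.mul_apply, hzv, map_mul, ih, AlgEquiv.commutes, pow_succ,
        map_mul]
      ring
  have hone : ∀ c ∈ Subgroup.center G, ρ c v = v → c = 1 := by
    intro c hc hcv
    obtain ⟨k, rfl⟩ := hcen c hc
    rw [hpow] at hcv
    have h1 : algebraMap K F (ζ ^ k) = 1 := mul_right_cancel₀ hv (hcv.trans (one_mul v).symm)
    rw [← map_one (algebraMap K F)] at h1
    obtain ⟨m, rfl⟩ := hζ.dvd_of_pow_eq_one k ((algebraMap K F).injective h1)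
    rw [pow_mul, hz, one_pow]
  -- The commutator of g and h is central and fixes `v`, so it is trivial. Applied to both
  -- generators this makes g central, and then g = 1 for the same reason.
  have hcommutes : ∀ h : G, ρ g (ρ h v) = ρ h v → g * h = h * g := by
    intro h hh
    have hc := hcomm g h
    have h1 : g * h = h * (g * h * g⁻¹ * h⁻¹) * g := by
      rw [Subgroup.mem_center_iff.mp hc h]; group
    have h2 : ρ (g * h * g⁻¹ * h⁻¹) v = v := by
      apply (ρ h).injective
      rw [← AlgEquiv.mul_apply, ← map_mul]
      conv_lhs => rw [← hgv]
      rw [← AlgEquiv.mul_apply, ← map_mul, ← h1, map_mul, AlgEquiv.mul_apply, hh]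
    rw [hone _ hc h2, mul_one] at h1
    exact h1
  have hgcen : g ∈ Subgroup.center G := by
    rw [Subgroup.mem_center_iff]
    intro h
    have hle : Subgroup.closure {a, b} ≤ Subgroup.centralizer {g} := by
      rw [Subgroup.closure_le]
      rintro _ (rfl | rfl) <;> rw [SetLike.mem_coe, Subgroup.mem_centralizer_singleton_iff]
      · exact (hcommutes _ hga).symm
      · exact (hcommutes _ hgb).symm
    rw [hgen] at hle
    exact Subgroup.mem_centralizer_singleton_iff.mp (hle (Subgroup.mem_top h))
  exact hone g hgcen hgv

/-- The vector `y₀` carries the character of ⟨a, z⟩ ≅ (ℤ/p)² that is trivial on a and sends z to ζ.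
Its translates by powers of `t` span the induced representation. -/
theorem IsRegularSystem.isRationalOver_of_noncentral_pow_eq_one {ρ : G →* (F ≃ₐ[K] F)} {X : G → F}
    (h : IsRegularSystem ρ X) {p : ℕ} (hp : p.Prime) (hcard : Nat.card G = p ^ 3)
    (hnonab : ¬ ∀ a b : G, a * b = b * a) {ζ : K} (hζ : IsPrimitiveRoot ζ p)
    (hpK : (p : K) ≠ 0) {a : G} (hac : a ∉ Subgroup.center G) (hap : a ^ p = 1) :
    IsRationalOver K (fixedField ρ.range) := by
  have := Fact.mk hp
  have : Finite G := Nat.finite_of_card_ne_zero (by rw [hcard]; exact (pow_pos hp.pos 3).ne')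
  have hζ0 : ζ ≠ 0 := hζ.ne_zero hp.ne_zero
  obtain ⟨t, ht⟩ : ∃ t, a * t ≠ t * a := by
    by_contra! hcon
    exact hac (Subgroup.mem_center_iff.mpr fun t ↦ (hcon t).symm)
  set z := a * t * a⁻¹ * t⁻¹ with hz
  have hzc : z ∈ Subgroup.center G := commutator_mem_center hp hcard hnonab a t
  have hzcomm : ∀ g, Commute z g := fun g ↦ (Subgroup.mem_center_iff.mp hzc g).symm
  have hz1 : z ≠ 1 := fun h1 ↦ ht (by
    have : a * t = z * (t * a) := by rw [hz]; group
    rw [this, h1, one_mul])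
  have hzp : z ^ p = 1 := pow_prime_eq_one_of_mem_center hp hcard hnonab hzc
  have hat : ∀ i : ℕ, a * t ^ i = z ^ i * (t ^ i * a) := by
    intro i
    induction i with
    | zero => simp
    | succ i ih =>
      rw [pow_succ, ← mul_assoc, ih, mul_assoc, mul_assoc, show a * t = z * (t * a) by rw [hz]; group,
        ← mul_assoc (t ^ i), ← (hzcomm (t ^ i)).eq, pow_succ]
      simp only [mul_assoc]
  set c : ℕ → ℕ → F := fun i j ↦ algebraMap K F (ζ⁻¹ ^ j) * X (a ^ i * z ^ j) with hc
  set y₀ : F := ∑ i ∈ Finset.range p, ∑ j ∈ Finset.range p, c i j with hy₀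
  have hshift : ∀ w : ℕ → F, w p = w 0 →
      ∑ i ∈ Finset.range p, w (i + 1) = ∑ i ∈ Finset.range p, w i := by
    intro w hw
    have := (Finset.sum_range_succ' w p).symm.trans (Finset.sum_range_succ w p)
    rwa [hw, add_left_inj] at this
  have hay₀ : ρ a y₀ = y₀ := by
    simp only [hy₀, map_sum]
    rw [← hshift (fun i ↦ ∑ j ∈ Finset.range p, c i j) (by simp [hc, hap])]
    refine Finset.sum_congr rfl fun i _ ↦ Finset.sum_congr rfl fun j _ ↦ ?_
    simp only [hc, map_mul, AlgEquiv.commutes, h.apply_var, ← mul_assoc, ← pow_succ']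
  have hzy₀ : ρ z y₀ = algebraMap K F ζ * y₀ := by
    simp only [hy₀, map_sum, Finset.mul_sum]
    refine Finset.sum_congr rfl fun i _ ↦ ?_
    rw [← hshift (fun j ↦ algebraMap K F ζ * c i j) (by
      simp only [hc, hzp, pow_zero, inv_pow, hζ.pow_eq_one, inv_one])]
    refine Finset.sum_congr rfl fun j _ ↦ ?_
    simp only [hc, map_mul, AlgEquiv.commutes, h.apply_var]
    rw [← mul_assoc z, (hzcomm (a ^ i)).eq, mul_assoc, ← pow_succ', ← mul_assoc (algebraMap K F ζ),
      ← map_mul, pow_succ' ζ⁻¹, mul_inv_cancel_left₀ hζ0]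
  have hy₀V : y₀ ∈ span K (Set.range X) := by
    refine sum_mem fun i _ ↦ sum_mem fun j _ ↦ ?_
    simp only [hc, ← Algebra.smul_def]
    exact smul_mem _ _ (subset_span ⟨_, rfl⟩)
  -- The elements a^i z^j with i, j < p are distinct: a has order p modulo the center. So no
  -- cancellation can occur between the variables.
  have hy₀0 : y₀ ≠ 0 := by
    let q : Fin p × Fin p → G := fun i ↦ a ^ (i.1 : ℕ) * z ^ (i.2 : ℕ)
    have hq : Function.Injective q := by
      rintro ⟨i, j⟩ ⟨i', j'⟩ hij
      have hoa : orderOf (a : G ⧸ Subgroup.center G) = p := by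
        refine orderOf_eq_prime ?_ ?_
        · rw [← QuotientGroup.mk_pow, hap, QuotientGroup.mk_one]
        · rwa [Ne, QuotientGroup.eq_one_iff]
      have hz' : (z : G ⧸ Subgroup.center G) = 1 := (QuotientGroup.eq_one_iff z).2 hzc
      have h1 : (a : G ⧸ Subgroup.center G) ^ (i : ℕ) = a ^ (i' : ℕ) := by
        have := congrArg (QuotientGroup.mk (s := Subgroup.center G)) hij
        simpa [q, hz'] using this
      have hi : (i : ℕ) = i' := pow_injOn_Iio_orderOf (by simp [hoa]) (by simp [hoa]) h1
      have hij' : a ^ (i : ℕ) * z ^ (j : ℕ) = a ^ (i' : ℕ) * z ^ (j' : ℕ) := hij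
      rw [hi, mul_right_inj] at hij'
      have hoz : orderOf z = p := orderOf_eq_prime hzp hz1
      have hj : (j : ℕ) = j' := pow_injOn_Iio_orderOf (by simp [hoz]) (by simp [hoz]) hij'
      exact Prod.ext (Fin.ext hi) (Fin.ext hj)
    intro h0
    have hlin := h.algebraicIndependent.linearIndependent.comp q hq
    have hsum : ∑ i : Fin p × Fin p, (ζ⁻¹ ^ (i.2 : ℕ)) • (X ∘ q) i = 0 := by
      rw [← h0, hy₀, Fintype.sum_prod_type, Finset.sum_range]
      refine Finset.sum_congr rfl fun i _ ↦ ?_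
      rw [Finset.sum_range]
      refine Finset.sum_congr rfl fun j _ ↦ ?_
      rw [Algebra.smul_def]
      rfl
    have := Fintype.linearIndependent_iff.mp hlin _ hsum (⟨0, hp.pos⟩, ⟨0, hp.pos⟩)
    simp at this
  -- As t^p is central it is z^k, so going once around the cycle multiplies by ε = ζ^k.
  obtain ⟨k, hk⟩ := exists_pow_eq_of_mem_center hp hcard hnonab hzc hz1
    (pow_prime_mem_center hp hcard hnonab t)
  have hzk : ∀ k : ℕ, ρ (z ^ k) y₀ = algebraMap K F (ζ ^ k) * y₀ := by
    intro k
    induction k with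
    | zero => simp
    | succ k ih =>
      rw [pow_succ, map_mul, AlgEquiv.mul_apply, hzy₀, map_mul, ih, AlgEquiv.commutes, pow_succ,
        map_mul]
      ring
  set y : ℕ → F := fun i ↦ ρ (t ^ i) y₀ with hy
  have hy0 : ∀ i, y i ≠ 0 := fun i ↦ (map_ne_zero _).2 hy₀0
  have hya : ∀ i, ρ a (y i) = algebraMap K F (ζ ^ i) * y i := by
    intro i
    simp only [hy]
    rw [← AlgEquiv.mul_apply, ← map_mul, hat, ((hzcomm (t ^ i * a)).pow_left i).eq, map_mul, map_mul,
      AlgEquiv.mul_apply, AlgEquiv.mul_apply, hzk, map_mul, map_mul, AlgEquiv.commutes,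
      AlgEquiv.commutes, hay₀]
  have hyt : ∀ i, ρ t (y i) = y (i + 1) := by
    intro i
    simp only [hy]
    rw [← AlgEquiv.mul_apply, ← map_mul, ← pow_succ']
  have hgen : Subgroup.closure {a, t} = ⊤ := closure_pair_eq_top hp hcard ht
  refine h.isRationalOver_of_monomial hp hcard hζ hpK (y := y) ?_
    (fun i ↦ h.apply_mem_span _ hy₀V) (ε := ζ ^ k) ?_ ?_ hgen hya hyt ?_
  · refine Module.End.eigenvectors_linearIndependent' ((ρ a).toLinearMap : Module.End K F)
      (fun i : Fin p ↦ ζ ^ (i : ℕ)) (fun i j hij ↦ Fin.ext (hζ.pow_inj i.2 j.2 hij)) _ fun i ↦ ?_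
    rw [Module.End.hasEigenvector_iff, Module.End.mem_eigenspace_iff]
    exact ⟨(hya i).trans (Algebra.smul_def _ _).symm, hy0 i⟩
  · rw [← pow_mul, mul_comm, pow_mul, hζ.pow_eq_one, one_pow]
  · intro i
    simp only [hy]
    rw [pow_add, ← hk, map_mul, AlgEquiv.mul_apply, hzk, map_mul, AlgEquiv.commutes]
  · intro g hg
    have h0 : y 0 = y₀ := by simp [hy]
    refine eq_one_of_fixes hζ hzp
      (fun g hg ↦ exists_pow_eq_of_mem_center hp hcard hnonab hzc hz1 hg)
      (commutator_mem_center hp hcard hnonab) hgen hy₀0 hzy₀ (h0 ▸ hg 0) ?_ ?_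
    · rw [hay₀]; exact h0 ▸ hg 0
    · rw [← h0, hyt]; exact hg _

/-- Every noncentral square equals the central involution z, so a and b satisfy the relations of i
and j, with z acting as −1 on the orbit of `X 1 - X z`. -/
theorem IsRegularSystem.isRationalOver_of_noncentral_sq_ne_one {ρ : G →* (F ≃ₐ[K] F)} {X : G → F}
    (h : IsRegularSystem ρ X) (hcard : Nat.card G = 2 ^ 3)
    (hnonab : ¬ ∀ a b : G, a * b = b * a) (h2 : (2 : K) ≠ 0)
    (hsq : ∀ a, a ∉ Subgroup.center G → a ^ 2 ≠ 1) :
    IsRationalOver K (fixedField ρ.range) := by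
  have hp := Nat.prime_two
  have : Finite G := Nat.finite_of_card_ne_zero (by rw [hcard]; norm_num)
  obtain ⟨a, b, hab⟩ : ∃ a b : G, a * b ≠ b * a := by simpa using hnonab
  set z := a * b * a⁻¹ * b⁻¹ with hz
  have hzc : z ∈ Subgroup.center G := commutator_mem_center hp hcard hnonab a b
  have hzcomm : ∀ g, z * g = g * z := fun g ↦ (Subgroup.mem_center_iff.mp hzc g).symm
  have habz : a * b = z * (b * a) := by rw [hz]; group
  have hz1 : z ≠ 1 := fun h1 ↦ hab (by rw [habz, h1, one_mul])
  have hz2 : z ^ 2 = 1 := pow_prime_eq_one_of_mem_center hp hcard hnonab hzc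
  have hzz : z * z = 1 := by rw [← sq, hz2]
  have hcen : ∀ g ∈ Subgroup.center G, g = 1 ∨ g = z := by
    intro g hg
    obtain ⟨k, rfl⟩ := exists_pow_eq_of_mem_center hp hcard hnonab hzc hz1 hg
    obtain ⟨m, rfl | rfl⟩ := k.even_or_odd'
    · left; rw [pow_mul, hz2, one_pow]
    · right; rw [pow_succ, pow_mul, hz2, one_pow, one_mul]
  have hsqz : ∀ g, g ∉ Subgroup.center G → g * g = z := by
    intro g hg
    rw [← sq]
    exact (hcen _ (pow_prime_mem_center hp hcard hnonab g)).resolve_left (hsq g hg)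
  have hac : a ∉ Subgroup.center G := fun ha ↦ hab (Subgroup.mem_center_iff.mp ha b).symm
  have hbc : b ∉ Subgroup.center G := fun hb ↦ hab (Subgroup.mem_center_iff.mp hb a)
  have haa := hsqz a hac
  have hbb := hsqz b hbc
  have hba : b * a = a * b * z := by
    rw [← hzcomm, habz, ← mul_assoc, hzz, one_mul]
  have hbab : b * (a * b) = a := by
    rw [habz, ← mul_assoc, ← hzcomm, mul_assoc, ← mul_assoc b, hbb, ← mul_assoc, hzz, one_mul]
  set w : F := X 1 - X z with hw
  have hzw : ρ z w = -w := by
    simp only [hw, map_sub, h.apply_var, mul_one, hzz]; ring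
  have hmul : ∀ g k : G, ρ g (ρ k w) = ρ (g * k) w := fun g k ↦ by
    rw [map_mul, AlgEquiv.mul_apply]
  have hmulz : ∀ g : G, ρ (g * z) w = -ρ g w := fun g ↦ by
    rw [map_mul, AlgEquiv.mul_apply, hzw, map_neg]
  have hwV : w ∈ span K (Set.range X) := sub_mem (subset_span ⟨_, rfl⟩) (subset_span ⟨_, rfl⟩)
  have hgen : Subgroup.closure {a, b} = ⊤ := closure_pair_eq_top hp hcard hab
  let g : Fin 4 → G := ![1, a, b, a * b]
  have hv : ![w, ρ a w, ρ b w, ρ (a * b) w] = fun i ↦ X (g i) - X (g i * z) := by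
    funext i
    fin_cases i <;> simp [g, hw, h.apply_var, mul_assoc]
  -- 1, a, b and ab lie in distinct cosets of the center, so the four differences involve eight
  -- distinct variables.
  have hg : ∀ i k, i ≠ k → (g i)⁻¹ * g k ∉ Subgroup.center G := by
    have h03 : a * b ∉ Subgroup.center G := fun hmem ↦ hab (by
      have := Subgroup.mem_center_iff.mp hmem b
      rw [← mul_assoc] at this
      exact (mul_right_cancel this).symm)
    have h12 : a⁻¹ * b ∉ Subgroup.center G := fun hmem ↦ hab (by
      have := Subgroup.mem_center_iff.mp hmem a
      rw [mul_inv_cancel_left, mul_assoc, eq_inv_mul_iff_mul_eq] at this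
      exact this)
    have h23 : b⁻¹ * (a * b) ∉ Subgroup.center G := fun hmem ↦ hab (by
      have := Subgroup.mem_center_iff.mp hmem b
      rw [mul_inv_cancel_left, mul_assoc, eq_inv_mul_iff_mul_eq, ← mul_assoc] at this
      exact (mul_right_cancel this).symm)
    have hlt : ∀ i k, i < k → (g i)⁻¹ * g k ∉ Subgroup.center G := by
      intro i k hik
      fin_cases i <;> fin_cases k <;> first | exact absurd hik (by decide) | simpa [g]
    intro i k hik
    rcases lt_or_gt_of_ne hik with hik | hik
    · exact hlt i k hik
    · intro hmem
      refine hlt k i hik ?_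
      have := inv_mem hmem
      rwa [mul_inv_rev, inv_inv] at this
  have hind : LinearIndependent K ![w, ρ a w, ρ b w, ρ (a * b) w] := by
    classical
    have := Fintype.ofFinite G
    rw [hv, Fintype.linearIndependent_iff]
    intro c hc k
    have hX := Fintype.linearIndependent_iff.mp h.algebraicIndependent.linearIndependent
      (fun x ↦ ∑ i, ((if x = g i then c i else 0) - (if x = g i * z then c i else 0))) (by
        rw [← hc]
        simp only [Finset.sum_smul, sub_smul, ite_smul, zero_smul]
        rw [Finset.sum_comm]
        refine Finset.sum_congr rfl fun i _ ↦ ?_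
        rw [Finset.sum_sub_distrib, Finset.sum_ite_eq', Finset.sum_ite_eq', smul_sub]
        simp) (g k)
    rw [Finset.sum_eq_single k] at hX
    · rw [if_pos rfl, if_neg (fun h ↦ hz1 (by simpa using h)), sub_zero] at hX
      exact hX
    · intro i _ hik
      rw [if_neg, if_neg, sub_zero]
      · intro hgk
        apply hg i k hik
        rw [hgk, inv_mul_cancel_left]
        exact hzc
      · intro hgk
        apply hg i k hik
        rw [hgk, inv_mul_cancel]
        exact one_mem _
    · simp
  have hw0 : w ≠ 0 := hind.ne_zero 0
  have hζ : IsPrimitiveRoot (-1 : K) 2 := by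
    refine IsPrimitiveRoot.mk_of_lt _ two_pos (by norm_num) fun l hl0 hl2 ↦ ?_
    obtain rfl : l = 1 := by omega
    rw [pow_one]
    intro h1
    apply h2
    linear_combination -h1
  refine h.isRationalOver_of_quaternion hcard h2 hind (fun i ↦ ?_) hgen rfl ?_ (hmul a b) ?_
    rfl ?_ ?_ ?_ fun k hkw hkx hky ↦ eq_one_of_fixes hζ hz2
      (fun g hg ↦ exists_pow_eq_of_mem_center hp hcard hnonab hzc hz1 hg)
      (commutator_mem_center hp hcard hnonab) hgen hw0 (by rw [hzw]; simp) hkw hkx hky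
  · fin_cases i
    · exact hwV
    all_goals exact h.apply_mem_span _ hwV
  · rw [hmul, haa, hzw]
  · rw [hmul, ← mul_assoc, haa, hzcomm, hmulz]
  · rw [hmul, hba, hmulz]
  · rw [hmul, hbb, hzw]
  · rw [hmul, hbab]

theorem isRegularSystem_regularAction (K G : Type*) [Field K] [Group G] :
    IsRegularSystem (regularAction K G)
      fun g ↦ algebraMap (MvPolynomial G K) (RegularFunctionField K G) (MvPolynomial.X g) where
  algebraicIndependent := (MvPolynomial.algebraicIndependent_X G K).map'
    (f := IsScalarTower.toAlgHom K (MvPolynomial G K) (RegularFunctionField K G))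
    (IsFractionRing.injective _ _)
  adjoin_eq_top := by
    rw [eq_top_iff]
    intro x _
    have hpoly : ∀ P, algebraMap (MvPolynomial G K) (RegularFunctionField K G) P ∈
        adjoin K (Set.range fun g ↦ algebraMap (MvPolynomial G K) (RegularFunctionField K G)
          (MvPolynomial.X g)) := by
      intro P
      induction P using MvPolynomial.induction_on with
      | C r => exact IntermediateField.algebraMap_mem _ r
      | add P Q hP hQ => rw [map_add]; exact add_mem hP hQ
      | mul_X P g hP => rw [map_mul]; exact mul_mem hP (subset_adjoin K _ ⟨g, rfl⟩)
    obtain ⟨P, Q, -, rfl⟩ := IsFractionRing.div_surjective (A := MvPolynomial G K) x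
    exact div_mem (hpoly P) (hpoly Q)
  apply_var g h := by
    change IsFractionRing.fieldEquivOfAlgEquiv K _ _ _ (algebraMap _ _ _) = _
    rw [IsFractionRing.fieldEquivOfAlgEquiv_algebraMap]
    simp

end Assembly

theorem theorem1p8 (p : ℕ) (hp : p.Prime) (G : Type*) [Group G] (hcard : Nat.card G = p ^ 3)
    (hnonab : ¬ ∀ a b : G, a * b = b * a) (K : Type*) [Field K]
    (hK : CharP K p ∨ (¬ CharP K p ∧ ∃ ζ : K, IsPrimitiveRoot ζ p)) :
    IsRationalOver K (noetherField K G) := by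
  have := Fact.mk hp
  have h := isRegularSystem_regularAction K G
  obtain hchar | ⟨-, ζ, hζ⟩ := hK
  · have : Finite G := Nat.finite_of_card_ne_zero (by rw [hcard]; exact (pow_pos hp.pos 3).ne')
    exact h.isRationalOver_of_charP (IsPGroup.of_card hcard)
  · have hpK : (p : K) ≠ 0 := (hζ.neZero').out
    by_cases hex : ∃ a, a ∉ Subgroup.center G ∧ a ^ p = 1
    · obtain ⟨a, hac, hap⟩ := hex
      exact h.isRationalOver_of_noncentral_pow_eq_one hp hcard hnonab hζ hpK hac hap
    · obtain rfl : p = 2 := by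
        by_contra hp2
        exact hex (exists_noncentral_pow_prime_eq_one hp hcard hnonab hp2)
      exact h.isRationalOver_of_noncentral_sq_ne_one hcard hnonab (by exact_mod_cast hpK)
        fun a hac ha ↦ hex ⟨a, hac, ha⟩
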